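/- Let $\mathrm{SL}(2,\mathbb{Z})$ be the group of $2\times 2$ integer matrices with determinant $1$. For $M=\begin{bmatrix} a & b\\ c & d\end{bmatrix}\in\mathrm{SL}(2,\mathbb{Z})$ let $f_M:\mathbb{Q}\cup\{\infty\}\to\mathbb{Q}\cup\{\infty\}$ be the fractional linear map $f_M(x)=\frac{ax+b}{cx+d}$, where $f_M(x)=\infty$ if $x\in\mathbb{Q}$ and $cx+d=0$, $f_M(\infty)=\frac ac$ if $c\ne 0$, and $f_M(\infty)=\infty$ if $c=0$. A product of no matrices is the identity matrix. Regular languages are given by nondeterministic finite automata that accept them. Then each of the following four problems is decidable, that is, there is one algorithm that halts on every input of the problem with the correct answer. 1. (Generalized vector reachability.) Given $M_1,\dots,M_n\in\mathrm{SL}(2,\mathbb{Z})$, a regular language $L\subseteq\{1,\dots,n\}^*$ and vectors $\mathbf{x},\mathbf{y}\in\mathbb{Z}^2$, decide whether there is a word $i_1\ldots i_k\in L$ such that $M_{i_1}\cdots M_{i_k}\mathbf{x}=\mathbf{y}$. 2. (Generalized reachability by fractional linear transformations.) Given $M_1,\dots,M_n\in\mathrm{SL}(2,\mathbb{Z})$,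 a regular language $L\subseteq\{1,\dots,n\}^*$ and rational numbers $x,y$, decide whether there is a word $i_1\ldots i_k\in L$ such that $f_{M_{i_1}\cdots M_{i_k}}(x)=y$. 3. Given $M_1,\dots,M_k,N_1,\dots,N_l\in\mathrm{SL}(2,\mathbb{Z})$ and vectors $\mathbf{x},\mathbf{y}\in\mathbb{Z}^2$, decide whether there are non-negative integers $x_1,\dots,x_k,y_1,\dots,y_l$ such that $M_1^{x_1}\cdots M_k^{x_k}\mathbf{x}=N_1^{y_1}\cdots N_l^{y_l}\mathbf{y}$. 4. The same problem as in 3, with arbitrary integers $x_1,\dots,x_k,y_1,\dots,y_l$. -/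

import Mathlib

open scoped MatrixGroups

noncomputable section

namespace SL2Reach

/-- A decision problem with inputs in `ι`, the inputs being written as finite data of type `γ` by
`enc`, is decidable: some algorithm, run on the code of any input, halts and answers whether the
input satisfies `Q`. `ComputablePred` is decidability in the sense of partial recursive functions.
What the algorithm answers on data that code no input is irrelevant. -/
def IsDecidable {ι γ : Type} [Primcodable γ] (enc : ι → γ) (Q : ι → Prop) : Prop :=
  ∃ p : γ → Prop, ComputablePred p ∧ ∀ i, p (enc i) ↔ Q i

/-- The fractional linear map `x ↦ (a x + b) / (c x + d)` on `ℚ ∪ {∞}` given by a matrix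
with rows `(a, b)` and `(c, d)`. -/
def flt (M : SL(2, ℤ)) : OnePoint ℚ → OnePoint ℚ
  | OnePoint.some x =>
      if (M 1 0 : ℚ) * x + M 1 1 = 0 then OnePoint.infty
      else OnePoint.some (((M 0 0 : ℚ) * x + M 0 1) / ((M 1 0 : ℚ) * x + M 1 1))
  | OnePoint.infty =>
      if M 1 0 = 0 then OnePoint.infty else OnePoint.some ((M 0 0 : ℚ) / (M 1 0 : ℚ))

/-! ### Codes of the inputs -/

/-- A matrix is given by its entries, row by row. -/
def encMat (M : SL(2, ℤ)) : (ℤ × ℤ) × (ℤ × ℤ) := ((M 0 0, M 0 1), (M 1 0, M 1 1))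

/-- A finite sequence of matrices is given by the list of its terms. -/
def encMats {n : ℕ} (M : Fin n → SL(2, ℤ)) : List ((ℤ × ℤ) × (ℤ × ℤ)) :=
  List.ofFn fun i => encMat (M i)

/-- A vector is given by its coordinates. -/
def encVec (x : Fin 2 → ℤ) : ℤ × ℤ := (x 0, x 1)

/-- A rational number is given by its numerator and denominator in lowest terms. -/
def encRat (x : ℚ) : ℤ × ℕ := (x.num, x.den)

open Classical in
/-- A subset of `{0, …, m - 1}` is given by the list of its elements. -/
def encSet {m : ℕ} (s : Set (Fin m)) : List ℕ :=
  ((List.finRange m).filter fun q => decide (q ∈ s)).map fun q => (q : ℕ)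

open Classical in
/-- The transitions `(q, a, r)` of a nondeterministic automaton, where `a` leads from `q` to `r`. -/
def encStep {n m : ℕ} (A : NFA (Fin n) (Fin m)) : List (ℕ × ℕ × ℕ) :=
  ((List.finRange m ×ˢ (List.finRange n ×ˢ List.finRange m)).filter
    fun t => decide (t.2.2 ∈ A.step t.1 t.2.1)).map
      fun t => ((t.1 : ℕ), (t.2.1 : ℕ), (t.2.2 : ℕ))

/-- A nondeterministic finite automaton is given by the number of its states and the lists of its
transitions, initial states and accepting states. -/
def encNFA {n m : ℕ} (A : NFA (Fin n) (Fin m)) :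
    ℕ × List (ℕ × ℕ × ℕ) × List ℕ × List ℕ :=
  (m, encStep A, encSet A.start, encSet A.accept)

/-! ### The generalized reachability problems -/

/-- An input of a generalized reachability problem: matrices `M₁, …, Mₙ`, a regular language `L`
over the set of indices, given by a finite automaton that accepts it, and two points. -/
structure RegularInput (V : Type) where
  /-- the number of matrices -/
  n : ℕ
  /-- the matrices -/
  M : Fin n → SL(2, ℤ)
  /-- the number of states of the automaton -/
  m : ℕ
  /-- the automaton -/
  A : NFA (Fin n) (Fin m)
  /-- the point to start from -/
  x : V
  /-- the point to be reached -/
  y : V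

/-- The language `L` of the input. -/
def RegularInput.lang {V : Type} (I : RegularInput V) : Language (Fin I.n) := I.A.accepts

/-- The product `M_{i₁} ⋯ M_{iₖ}` indexed by the word `i₁ … iₖ`. -/
def RegularInput.wordProd {V : Type} (I : RegularInput V) (w : List (Fin I.n)) : SL(2, ℤ) :=
  (w.map I.M).prod

/-- The code of an input, where points are written by `encV`. -/
def RegularInput.enc {V β : Type} (encV : V → β) (I : RegularInput V) :
    List ((ℤ × ℤ) × (ℤ × ℤ)) × (ℕ × List (ℕ × ℕ × ℕ) × List ℕ × List ℕ) × β × β :=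
  (encMats I.M, encNFA I.A, encV I.x, encV I.y)

/-- Some word `w` of the language has `M_w x = y`. -/
def VectorReachable (I : RegularInput (Fin 2 → ℤ)) : Prop :=
  ∃ w ∈ I.lang, (I.wordProd w : Matrix (Fin 2) (Fin 2) ℤ).mulVec I.x = I.y

/-- Some word `w` of the language has `f_{M_w}(x) = y`. -/
def FLTReachable (I : RegularInput ℚ) : Prop :=
  ∃ w ∈ I.lang, flt (I.wordProd w) (OnePoint.some I.x) = OnePoint.some I.y

/-! ### The matrix equation -/

/-- An input of the problem to solve `M₁^{x₁} ⋯ Mₖ^{xₖ} x = N₁^{y₁} ⋯ Nₗ^{yₗ} y`. -/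
structure EquationInput where
  /-- the number of matrices on the left -/
  k : ℕ
  /-- the matrices on the left -/
  M : Fin k → SL(2, ℤ)
  /-- the number of matrices on the right -/
  l : ℕ
  /-- the matrices on the right -/
  N : Fin l → SL(2, ℤ)
  /-- the vector on the left -/
  x : Fin 2 → ℤ
  /-- the vector on the right -/
  y : Fin 2 → ℤ

/-- The code of an input. -/
def EquationInput.enc (I : EquationInput) :
    List ((ℤ × ℤ) × (ℤ × ℤ)) × List ((ℤ × ℤ) × (ℤ × ℤ)) × (ℤ × ℤ) × (ℤ × ℤ) :=
  (encMats I.M, encMats I.N, encVec I.x, encVec I.y)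

/-- The ordered product `M₁^{e₁} ⋯ Mₖ^{eₖ}`. -/
def powProd {k : ℕ} (M : Fin k → SL(2, ℤ)) (e : Fin k → ℤ) : SL(2, ℤ) :=
  (List.ofFn fun i => M i ^ e i).prod

/-- The equation holds for the given exponents. -/
def EquationInput.Holds (I : EquationInput) (e : Fin I.k → ℤ) (f : Fin I.l → ℤ) : Prop :=
  (powProd I.M e : Matrix (Fin 2) (Fin 2) ℤ).mulVec I.x =
    (powProd I.N f : Matrix (Fin 2) (Fin 2) ℤ).mulVec I.y

/-- The equation has a solution in non-negative integer exponents. -/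
def EquationInput.SolvableNat (I : EquationInput) : Prop :=
  ∃ (e : Fin I.k → ℕ) (f : Fin I.l → ℕ), I.Holds (fun i => (e i : ℤ)) (fun j => (f j : ℤ))

/-- The equation has a solution in arbitrary integer exponents. -/
def EquationInput.SolvableInt (I : EquationInput) : Prop :=
  ∃ (e : Fin I.k → ℤ) (f : Fin I.l → ℤ), I.Holds e f

end SL2Reach

end

namespace SL2Reach

/-! ### Decidability from certificates -/

section Computability

variable {α β γ κ : Type} [Primcodable α] [Primcodable β] [Primcodable γ] [Primcodable κ]

/-! All four problems reduce to one: in a finite graph whose edges carry words in `S` and `S * T`,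
does some path from `0` to `1` have value `1` (`IdentityPath`)? It suffices that yes and no both
have certificates checkable by a primitive recursive relation, since a search for either one halts
(`computablePred_of_certificates`).

A yes-certificate is a path. For no-certificates, the free product structure of PSL(2, ℤ) enters: a
ping-pong argument on the vector (1, 1) shows that a nonempty word without factors `S²` or `(ST)³`
never has value ±1 (`Reduced.eq_nil`). As both factors equal -1, the words of value ±1 form a
context-free language with the grammar `Trivial` (`trivial_of_eval`). Hence a finite set of facts
closed under the grammar rules and missing the target fact refutes the path
(`not_identityPath_iff`).

For vectors, Bézout gives A x = (d, 0) and B y = (d', 0) with d, d' ≥ 0. Then u x = y iff d = d' and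
u A⁻¹ K B = 1 for some K fixing (d, 0). That stabilizer is generated by `T` when d ≠ 0 and is the
whole group when d = 0, so K is spelled by loops at one vertex, and the condition is an identity
path in an enlarged graph (`vectorPath_iff`).

An automaton is such a graph once its letters become words. A fractional linear map sends x to y iff
its matrix sends the reduced pair of x to plus or minus that of y (`flt_eq_iff`). In the matrix
equation the right-hand product is moved to the left as an inverse, and ordered products of powers
are read off a chain of loops (`exists_run_powGraph_iff`). -/

theorem exists_computable_of_search {R : γ → κ → Prop} (hR : PrimrecRel R)
    (h : ∀ c, ∃ k, R c k) : ∃ f : γ → κ, Computable f ∧ ∀ c, R c (f c) := by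
  classical
  have hdec : Primrec₂ fun (c : γ) (n : ℕ) =>
      (Encodable.decode (α := κ) n).bind fun k => if R c k then some k else none := by
    refine Primrec.option_bind (Primrec.decode.comp Primrec.snd) ?_
    exact Primrec.ite (hR.comp (Primrec.fst.comp Primrec.fst) Primrec.snd)
      (Primrec.option_some.comp Primrec.snd) (Primrec.const none)
  have hpart := Partrec.rfindOpt hdec.to_comp
  have hdom : ∀ c, (Nat.rfindOpt fun n => (Encodable.decode (α := κ) n).bind fun k =>
      if R c k then some k else none).Dom := by
    intro c
    obtain ⟨k, hk⟩ := h c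
    exact Nat.rfindOpt_dom.2 ⟨Encodable.encode k, k, by simp [hk]⟩
  refine ⟨fun c => (Nat.rfindOpt _).get (hdom c),
    hpart.of_eq_tot fun c => Part.get_mem _, fun c => ?_⟩
  obtain ⟨n, hn⟩ := Nat.rfindOpt_spec (Part.get_mem (hdom c))
  simp only [Option.mem_def, Option.bind_eq_some_iff] at hn
  obtain ⟨k, -, hk⟩ := hn
  split_ifs at hk with hRk
  have hk' := Option.some_injective _ hk
  dsimp only
  exact hk' ▸ hRk

/-- This is Post's theorem. The search runs over pairs of optional certificates; afterwards it only
remains to check whether the positive one was found. -/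
theorem computablePred_of_certificates {Q : γ → Prop} {A : γ → α → Prop} {B : γ → β → Prop}
    (hA : PrimrecRel A) (hB : PrimrecRel B) (hQA : ∀ c, Q c ↔ ∃ a, A c a)
    (hQB : ∀ c, ¬ Q c ↔ ∃ b, B c b) : ComputablePred Q := by
  classical
  obtain ⟨f, hf, hfR⟩ := exists_computable_of_search (γ := γ) (κ := Option α × Option β)
    (R := fun c k => (∃ a ∈ k.1.toList, A c a) ∨ (∃ b ∈ k.2.toList, B c b))
    (by
      have hA' := (PrimrecRel.exists_mem_list (R := fun a c => A c a)
        (hA.comp Primrec.snd Primrec.fst))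
      have hB' := (PrimrecRel.exists_mem_list (R := fun a c => B c a)
        (hB.comp Primrec.snd Primrec.fst))
      exact (hA'.comp (Primrec.optionToList.comp (Primrec.fst.comp Primrec.snd)) Primrec.fst).or
        (hB'.comp (Primrec.optionToList.comp (Primrec.snd.comp Primrec.snd)) Primrec.fst))
    (by
      intro c
      by_cases hQ : Q c
      · obtain ⟨a, ha⟩ := (hQA c).1 hQ
        exact ⟨(some a, none), by simp [ha]⟩
      · obtain ⟨b, hb⟩ := (hQB c).1 hQ
        exact ⟨(none, some b), by simp [hb]⟩)
  have hA' : PrimrecPred fun q : γ × (Option α × Option β) => ∃ a ∈ q.2.1.toList, A q.1 a := by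
    have hA' := (PrimrecRel.exists_mem_list (R := fun a c => A c a)
        (hA.comp Primrec.snd Primrec.fst))
    exact (hA'.comp (Primrec.optionToList.comp (Primrec.fst.comp Primrec.snd)) Primrec.fst)
  refine ComputablePred.computable_iff.2 ⟨fun c => decide (∃ a ∈ (f c).1.toList, A c a), ?_, ?_⟩
  · exact (hA'.decide).to_comp.comp (Computable.id.pair hf)
  · funext c
    rw [decide_eq_true_iff, eq_iff_iff]
    constructor
    · intro hQ
      rcases hfR c with h | ⟨b, -, hb⟩
      · exact h
      · exact absurd hQ ((hQB c).2 ⟨b, hb⟩)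
    · rintro ⟨a, -, ha⟩
      exact (hQA c).2 ⟨a, ha⟩

theorem _root_.ComputablePred.comp_computable {Q : β → Prop} {f : α → β}
    (hQ : ComputablePred Q) (hf : Computable f) : ComputablePred fun a => Q (f a) := by
  obtain ⟨g, hg, rfl⟩ := ComputablePred.computable_iff.1 hQ
  exact ComputablePred.computable_iff.2 ⟨fun a => g (f a), hg.comp hf, rfl⟩

theorem primrecPred_forall_mem {f : α → List β} {R : α → β → Prop} (hf : Primrec f)
    (hR : PrimrecRel R) : PrimrecPred fun a => ∀ b ∈ f a, R a b :=
  (PrimrecRel.forall_mem_list (R := fun b a => R a b) (hR.comp Primrec.snd Primrec.fst)).comp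
    hf Primrec.id

theorem primrecPred_exists_mem {f : α → List β} {R : α → β → Prop} (hf : Primrec f)
    (hR : PrimrecRel R) : PrimrecPred fun a => ∃ b ∈ f a, R a b :=
  (PrimrecRel.exists_mem_list (R := fun b a => R a b) (hR.comp Primrec.snd Primrec.fst)).comp
    hf Primrec.id

theorem primrecPred_mem {f : α → β} {g : α → List β} (hf : Primrec f) (hg : Primrec g) :
    PrimrecPred fun a => f a ∈ g a :=
  (primrecPred_exists_mem hg
    (R := fun a b => b = f a) (Primrec.eq.comp Primrec.snd (hf.comp Primrec.fst))).of_eq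
    fun a => by simp

theorem primrecPred_imp {p q : α → Prop} (hp : PrimrecPred p) (hq : PrimrecPred q) :
    PrimrecPred fun a => p a → q a :=
  (hp.not.or hq).of_eq fun a => by tauto

end Computability

-- Composition rules for primitive recursive functions

attribute [fun_prop] Primrec
attribute [fun_prop] Primrec.id Primrec.const Primrec.comp Primrec.pair Primrec.fst Primrec.snd
attribute [fun_prop] Primrec.list_tail Primrec.list_head? Primrec.list_reverse Primrec.list_length
attribute [fun_prop] Primrec.not

section PrimrecComposition

variable {α β σ : Type} [Primcodable α] [Primcodable β] [Primcodable σ]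

@[fun_prop]
theorem primrec_cons {f : α → β} {g : α → List β} (hf : Primrec f) (hg : Primrec g) :
    Primrec fun a => f a :: g a := Primrec.list_cons.comp hf hg

@[fun_prop]
theorem primrec_append {f g : α → List β} (hf : Primrec f) (hg : Primrec g) :
    Primrec fun a => f a ++ g a := Primrec.list_append.comp hf hg

@[fun_prop]
theorem primrec_add {f g : α → ℕ} (hf : Primrec f) (hg : Primrec g) :
    Primrec fun a => f a + g a := Primrec.nat_add.comp hf hg

@[fun_prop]
theorem primrec_xor {f g : α → Bool} (hf : Primrec f) (hg : Primrec g) :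
    Primrec fun a => f a ^^ g a := (Primrec.dom_bool₂ Bool.xor).comp hf hg

@[fun_prop]
theorem primrec_getD {f : α → List β} {g : α → ℕ} {d : β} (hf : Primrec f) (hg : Primrec g) :
    Primrec fun a => (f a).getD (g a) d := (Primrec.list_getD d).comp hf hg

@[fun_prop]
theorem primrec_map {f : α → List β} {g : α → β → σ} (hf : Primrec f)
    (hg : Primrec fun p : α × β => g p.1 p.2) : Primrec fun a => (f a).map (g a) :=
  Primrec.list_map hf hg

@[fun_prop]
theorem primrec_flatMap {f : α → List β} {g : α → β → List σ} (hf : Primrec f)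
    (hg : Primrec fun p : α × β => g p.1 p.2) : Primrec fun a => (f a).flatMap (g a) :=
  Primrec.list_flatMap hf hg

end PrimrecComposition

/-! ### Integer arithmetic is primitive recursive -/

section IntArithmetic

theorem int_encode_ofNat (n : ℕ) : Encodable.encode (n : ℤ) = 2 * n := rfl

theorem int_encode_negSucc (n : ℕ) : Encodable.encode (Int.negSucc n) = 2 * n + 1 := rfl

theorem primrec_int_toNat : Primrec Int.toNat := by
  refine (Primrec.ite (c := fun z : ℤ => Encodable.encode z % 2 = 0)
    (Primrec.eq.comp (Primrec.nat_mod.comp Primrec.encode (Primrec.const 2)) (Primrec.const 0))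
    (Primrec.nat_div.comp Primrec.encode (Primrec.const 2)) (Primrec.const 0)).of_eq ?_
  rintro (n | n)
  · simp [int_encode_ofNat]
  · rw [int_encode_negSucc, if_neg (by omega)]; simp

theorem primrec_int_neg_toNat : Primrec fun z : ℤ => (-z).toNat := by
  refine (Primrec.ite (c := fun z : ℤ => Encodable.encode z % 2 = 0)
    (Primrec.eq.comp (Primrec.nat_mod.comp Primrec.encode (Primrec.const 2)) (Primrec.const 0))
    (Primrec.const 0)
    (Primrec.succ.comp (Primrec.nat_div.comp Primrec.encode (Primrec.const 2)))).of_eq ?_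
  rintro (n | n)
  · simp [int_encode_ofNat]
  · rw [int_encode_negSucc, if_neg (by omega)]
    have : (-(Int.negSucc n)).toNat = n + 1 := rfl
    omega

/-- Integer operations reduce to this one: split each argument into positive and negative part,
compute in `ℕ`, and subtract. -/
theorem primrec_natCast_sub : Primrec₂ fun m n : ℕ => (m : ℤ) - n := by
  have h : Primrec fun p : ℕ × ℕ => if p.2 ≤ p.1 then 2 * (p.1 - p.2)
      else 2 * (p.2 - p.1 - 1) + 1 := by
    refine Primrec.ite (Primrec.nat_le.comp Primrec.snd Primrec.fst)
      (Primrec.nat_double.comp (Primrec.nat_sub.comp Primrec.fst Primrec.snd))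
      (Primrec.nat_double_succ.comp (Primrec.nat_sub.comp
        (Primrec.nat_sub.comp Primrec.snd Primrec.fst) (Primrec.const 1)))
  refine Primrec.encode_iff.1 (h.of_eq ?_)
  rintro ⟨m, n⟩
  dsimp only
  split_ifs with hmn
  · rw [show (m : ℤ) - n = ((m - n : ℕ) : ℤ) by omega, int_encode_ofNat]
  · rw [show (m : ℤ) - n = Int.negSucc (n - m - 1) by omega, int_encode_negSucc]

theorem primrec_int_add : Primrec₂ ((· + ·) : ℤ → ℤ → ℤ) := by
  refine (primrec_natCast_sub.comp
    (Primrec.nat_add.comp (primrec_int_toNat.comp Primrec.fst) (primrec_int_toNat.comp Primrec.snd))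
    (Primrec.nat_add.comp (primrec_int_neg_toNat.comp Primrec.fst)
      (primrec_int_neg_toNat.comp Primrec.snd)) : Primrec _).of_eq ?_
  rintro ⟨a, b⟩
  dsimp only
  omega

theorem primrec_int_neg : Primrec ((- ·) : ℤ → ℤ) := by
  refine (primrec_natCast_sub.comp primrec_int_neg_toNat primrec_int_toNat).of_eq ?_
  intro a
  omega

theorem primrec_int_mul : Primrec₂ ((· * ·) : ℤ → ℤ → ℤ) := by
  have t1 := primrec_int_toNat.comp (Primrec.fst (α := ℤ) (β := ℤ))
  have t2 := primrec_int_toNat.comp (Primrec.snd (α := ℤ) (β := ℤ))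
  have n1 := primrec_int_neg_toNat.comp (Primrec.fst (α := ℤ) (β := ℤ))
  have n2 := primrec_int_neg_toNat.comp (Primrec.snd (α := ℤ) (β := ℤ))
  refine (primrec_natCast_sub.comp
    (Primrec.nat_add.comp (Primrec.nat_mul.comp t1 t2) (Primrec.nat_mul.comp n1 n2))
    (Primrec.nat_add.comp (Primrec.nat_mul.comp t1 n2) (Primrec.nat_mul.comp n1 t2)) :
      Primrec _).of_eq ?_
  rintro ⟨a, b⟩
  dsimp only
  push_cast
  have ha : a = (a.toNat : ℤ) - ((-a).toNat : ℤ) := by omega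
  have hb : b = (b.toNat : ℤ) - ((-b).toNat : ℤ) := by omega
  conv_rhs => rw [ha, hb]
  ring

@[fun_prop]
theorem primrec_natCast_int {α : Type} [Primcodable α] {f : α → ℕ} (hf : Primrec f) :
    Primrec fun a => (f a : ℤ) :=
  (primrec_natCast_sub.comp hf (Primrec.const 0)).of_eq fun _ => by simp

@[fun_prop]
theorem primrec_int_add_comp {α : Type} [Primcodable α] {f g : α → ℤ} (hf : Primrec f)
    (hg : Primrec g) : Primrec fun a => f a + g a := primrec_int_add.comp hf hg

@[fun_prop]
theorem primrec_int_neg_comp {α : Type} [Primcodable α] {f : α → ℤ} (hf : Primrec f) :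
    Primrec fun a => -f a := primrec_int_neg.comp hf

@[fun_prop]
theorem primrec_int_mul_comp {α : Type} [Primcodable α] {f g : α → ℤ} (hf : Primrec f)
    (hg : Primrec g) : Primrec fun a => f a * g a := primrec_int_mul.comp hf hg

end IntArithmetic

/-! ### Words in the generators `S` and `S * T` -/

/-- The generators `S`, of order 4, and `S * T`, of order 6. -/
def gen : Bool → SL(2, ℤ)
  | false => ModularGroup.S
  | true => ModularGroup.S * ModularGroup.T

/-- The value of a word in the generators. -/
def eval (w : List Bool) : SL(2, ℤ) := (w.map gen).prod

@[simp] theorem eval_nil : eval [] = 1 := rfl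

@[simp] theorem eval_cons (a : Bool) (w : List Bool) : eval (a :: w) = gen a * eval w := rfl

@[simp] theorem eval_append (u v : List Bool) : eval (u ++ v) = eval u * eval v := by
  simp [eval]

theorem gen_false_sq : gen false * gen false = -1 := by decide

theorem gen_true_cube : gen true * (gen true * gen true) = -1 := by decide

/-- 12 is the least common multiple of the orders 4 and 6, so the eleventh power inverts either
generator and inverses need no extra letters. -/
theorem gen_pow_twelve (a : Bool) : gen a ^ 12 = 1 := by
  cases a <;> decide

/-- A word whose value is the inverse of the value of the given word. -/
def invWord (w : List Bool) : List Bool := w.reverse.flatMap fun a => List.replicate 11 a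

theorem eval_invWord (w : List Bool) : eval (invWord w) = (eval w)⁻¹ := by
  induction w with
  | nil => simp [invWord]
  | cons a w ih =>
    have h : eval (List.replicate 11 a) = (gen a)⁻¹ := by
      rw [eq_inv_iff_mul_eq_one, eval, List.map_replicate, List.prod_replicate, ← pow_succ,
        gen_pow_twelve]
    simp only [invWord] at ih
    rw [invWord, List.reverse_cons, List.flatMap_append, eval_append, ih, eval_cons, mul_inv_rev,
      List.flatMap_singleton, h]

theorem exists_eval_eq (M : SL(2, ℤ)) : ∃ w, eval w = M := by
  have hM : M ∈ Subgroup.closure {ModularGroup.S, ModularGroup.T} := by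
    rw [SpecialLinearGroup.SL2Z_generators]; trivial
  induction hM using Subgroup.closure_induction with
  | mem x hx =>
    rcases hx with rfl | rfl
    · exact ⟨[false], by simp [gen]⟩
    -- `T = S⁻¹ * (S * T)`.
    · exact ⟨invWord [false] ++ [true], by rw [eval_append, eval_invWord]; simp [gen]⟩
  | one => exact ⟨[], rfl⟩
  | mul x y _ _ hx hy =>
    obtain ⟨u, rfl⟩ := hx
    obtain ⟨v, rfl⟩ := hy
    exact ⟨u ++ v, eval_append u v⟩
  | inv x _ hx =>
    obtain ⟨u, rfl⟩ := hx
    exact ⟨invWord u, eval_invWord u⟩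

/-! ### The action on vectors -/

/-- The action of a generator on a vector. -/
def genAct (a : Bool) (v : ℤ × ℤ) : ℤ × ℤ := (-v.2, if a then v.1 + v.2 else v.1)

/-- The action of a word on a vector. -/
def act (w : List Bool) (v : ℤ × ℤ) : ℤ × ℤ := w.foldr genAct v

@[simp] theorem act_nil (v : ℤ × ℤ) : act [] v = v := rfl

@[simp] theorem act_cons (a : Bool) (w : List Bool) (v : ℤ × ℤ) :
    act (a :: w) v = genAct a (act w v) := rfl

/-- The product of a matrix and a vector given by its coordinates. -/
def apply (M : SL(2, ℤ)) (v : ℤ × ℤ) : ℤ × ℤ :=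
  (M 0 0 * v.1 + M 0 1 * v.2, M 1 0 * v.1 + M 1 1 * v.2)

theorem apply_encVec (M : SL(2, ℤ)) (x : Fin 2 → ℤ) :
    apply M (encVec x) = encVec ((M : Matrix (Fin 2) (Fin 2) ℤ).mulVec x) := by
  simp [apply, encVec, Matrix.mulVec, dotProduct, Fin.sum_univ_two]

theorem apply_one (v : ℤ × ℤ) : apply 1 v = v := by
  simp [apply]

theorem apply_mul (M N : SL(2, ℤ)) (v : ℤ × ℤ) : apply (M * N) v = apply M (apply N v) := by
  simp only [apply, Matrix.SpecialLinearGroup.coe_mul, Matrix.mul_apply, Fin.sum_univ_two,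
    Prod.mk.injEq]
  constructor <;> ring

theorem apply_neg_one (v : ℤ × ℤ) : apply (-1) v = -v := by
  ext <;> simp [apply]

theorem apply_eq_iff (M : SL(2, ℤ)) (u v : ℤ × ℤ) : apply M u = v ↔ u = apply M⁻¹ v := by
  constructor
  · rintro rfl; rw [← apply_mul, inv_mul_cancel, apply_one]
  · rintro rfl; rw [← apply_mul, mul_inv_cancel, apply_one]

theorem apply_gen (a : Bool) (v : ℤ × ℤ) : apply (gen a) v = genAct a v := by
  cases a <;> ext <;>
    simp [apply, gen, genAct, ModularGroup.coe_S, ModularGroup.coe_T, Matrix.mul_apply,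
      Fin.sum_univ_two]

theorem act_eq_apply (w : List Bool) (v : ℤ × ℤ) : act w v = apply (eval w) v := by
  induction w with
  | nil => rw [act_nil, eval_nil, apply_one]
  | cons a w ih => rw [act_cons, eval_cons, apply_mul, apply_gen, ih]

/-! ### Reduced words -/

/-- The shape of the vector obtained from `(1, 1)` by a reduced word with the given first
letters. -/
def Shape : List Bool → ℤ × ℤ → Prop
  | [], v => v = (1, 1)
  | false :: _, v => ∃ a b : ℤ, 1 ≤ a ∧ 1 ≤ b ∧ 3 ≤ a + b ∧ (v = (a, b) ∨ v = (-a, -b))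
  | true :: true :: _, v => ∃ a b : ℤ, 1 ≤ a ∧ 1 ≤ b ∧ (v = (-a - b, a) ∨ v = (a + b, -a))
  | true :: _, v => ∃ a b : ℤ, 1 ≤ a ∧ 1 ≤ b ∧ (v = (-b, a + b) ∨ v = (b, -a - b))

/-- A word with no factor `S²` or `(S * T)³`. -/
def Reduced (w : List Bool) : Prop :=
  ¬ [false, false] <:+: w ∧ ¬ [true, true, true] <:+: w

theorem Reduced.of_isInfix {u w : List Bool} (hw : Reduced w) (h : u <:+: w) : Reduced u :=
  ⟨fun h' => hw.1 (h'.trans h), fun h' => hw.2 (h'.trans h)⟩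

/-- Ping-pong, up to sign: `S` swaps the equal-sign and opposite-sign quadrants; `S * T` sends the
equal-sign quadrant to the cone |x| < |y| of the other, and that cone to |x| > |y|. The appended
`false` keeps `w` from ending in `S`, as S(1, 1) = (-1, 1) lies on the line between these two cones.
-/
theorem shape_act (w : List Bool) (hw : Reduced (w ++ [false])) : Shape w (act w (1, 1)) := by
  induction w with
  | nil => rfl
  | cons a w ih =>
    have ih := ih (hw.of_isInfix (List.suffix_cons _ _).isInfix)
    rw [act_cons]
    generalize act w (1, 1) = v at ih
    match a, w with
    | false, [] => exact absurd (by simp) hw.1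
    | false, false :: w => exact absurd ⟨[], w ++ [false], by simp⟩ hw.1
    | false, [true] | false, true :: false :: w =>
      obtain ⟨a, b, ha, hb, rfl | rfl⟩ := ih
      · exact ⟨a + b, b, by omega, by omega, by omega, by right; simp [genAct]; try ring⟩
      · exact ⟨a + b, b, by omega, by omega, by omega, by left; simp [genAct]; try ring⟩
    | false, true :: true :: w =>
      obtain ⟨a, b, ha, hb, rfl | rfl⟩ := ih
      · exact ⟨a, a + b, by omega, by omega, by omega, by right; simp [genAct]; try ring⟩
      · exact ⟨a, a + b, by omega, by omega, by omega, by left; simp [genAct]; try ring⟩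
    | true, [] =>
      rw [show v = (1, 1) from ih]
      exact ⟨1, 1, le_rfl, le_rfl, by left; simp [genAct]⟩
    | true, false :: w =>
      obtain ⟨a, b, ha, hb, -, rfl | rfl⟩ := ih
      · exact ⟨a, b, ha, hb, by left; simp [genAct]⟩
      · exact ⟨a, b, ha, hb, by right; simp [genAct]; ring⟩
    | true, [true] | true, true :: false :: w =>
      obtain ⟨a, b, ha, hb, rfl | rfl⟩ := ih
      · exact ⟨a, b, ha, hb, by left; simp [genAct]; ring⟩
      · exact ⟨a, b, ha, hb, by right; simp [genAct]; try ring⟩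
    | true, true :: true :: w => exact absurd ⟨[], w ++ [false], by simp⟩ hw.2

theorem Shape.eq_nil {w : List Bool} {v : ℤ × ℤ} (h : Shape w v)
    (hv : v = (1, 1) ∨ v = (-1, -1)) : w = [] := by
  match w with
  | [] => rfl
  | false :: _ =>
    obtain ⟨a, b, ha, hb, hab, rfl | rfl⟩ := h <;> simp only [Prod.mk.injEq] at hv <;> omega
  | [true] | true :: false :: _ | true :: true :: _ =>
    obtain ⟨a, b, ha, hb, rfl | rfl⟩ := h <;> simp only [Prod.mk.injEq] at hv <;> omega

theorem Shape.ne {w : List Bool} {v : ℤ × ℤ} (h : Shape w v) : v ≠ (1, -1) ∧ v ≠ (-1, 1) := by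
  match w with
  | [] => rw [show v = (1, 1) from h]; decide
  | false :: _ =>
    obtain ⟨a, b, ha, hb, hab, rfl | rfl⟩ := h <;> simp only [ne_eq, Prod.mk.injEq] <;> omega
  | [true] | true :: false :: _ | true :: true :: _ =>
    obtain ⟨a, b, ha, hb, rfl | rfl⟩ := h <;> simp only [ne_eq, Prod.mk.injEq] <;> omega

/-- A word of value ±1 fixes every vector up to sign. If it ends in `S`, test it on (1, -1), which
this last letter sends to (1, 1); if it ends in `S * T`, test it on (1, 1) itself. -/
theorem Reduced.eq_nil {w : List Bool} (hw : Reduced w) (h : eval w = 1 ∨ eval w = -1) :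
    w = [] := by
  have hact : ∀ v, act w v = v ∨ act w v = -v := by
    intro v
    rw [act_eq_apply]
    rcases h with h | h <;> rw [h]
    · exact Or.inl (apply_one v)
    · exact Or.inr (apply_neg_one v)
  rcases List.eq_nil_or_concat w with rfl | ⟨u, a, rfl⟩
  · rfl
  rw [List.concat_eq_append] at *
  cases a
  · have hs := shape_act u hw
    have h1 := hact (1, -1)
    rw [act, List.foldr_append] at h1
    have h2 := hs.ne
    rw [act] at h2
    simp [genAct] at h1
    simp at h2
    tauto
  · have hs := shape_act (u ++ [true]) (by
      refine ⟨fun h => ?_, fun h => ?_⟩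
      · rw [List.infix_concat_iff] at h
        rcases h with h | h
        · exact absurd h (by
            rintro ⟨s, hs⟩
            have := congrArg (fun l => l.reverse) hs
            simp at this)
        · exact hw.1 h
      · rw [List.infix_concat_iff] at h
        rcases h with h | h
        · exact absurd h (by
            rintro ⟨s, hs⟩
            have := congrArg (fun l => l.reverse) hs
            simp at this)
        · exact hw.2 h)
    exact hs.eq_nil (by simpa using hact (1, 1))

/-! ### Words of value `1` or `-1` -/

/-- The words of value `1` or `-1`, generated by insertions of `S²` and `(S * T)³`; the Boolean
tells whether the value is `-1`. -/
inductive Trivial : List Bool → Bool → Prop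
  | nil : Trivial [] false
  | two {u v : List Bool} {a b : Bool} : Trivial u a → Trivial v b →
      Trivial (false :: u ++ false :: v) (!(a ^^ b))
  | three {u v w : List Bool} {a b c : Bool} : Trivial u a → Trivial v b → Trivial w c →
      Trivial (true :: u ++ true :: v ++ true :: w) (!(a ^^ b ^^ c))

/-- Insertion at the front is the hypothesis on `k`; any other insertion point lies inside, or at
the end of, one of the smaller trivial factors of the derivation. -/
theorem Trivial.insert {k : List Bool} (hk : ∀ w a, Trivial w a → Trivial (k ++ w) (!a))
    {w : List Bool} {a : Bool} (h : Trivial w a) :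
    ∀ u v, w = u ++ v → Trivial (u ++ (k ++ v)) (!a) := by
  induction h with
  | nil =>
    intro u v h
    obtain ⟨rfl, rfl⟩ := List.append_eq_nil_iff.1 h.symm
    exact hk [] false .nil
  | @two x y a b hx hy ihx ihy =>
    intro u v h
    rcases u with _ | ⟨c, u⟩
    · rw [List.nil_append] at h ⊢
      exact h ▸ hk _ _ (.two hx hy)
    rw [List.cons_append, List.cons_append, List.cons.injEq] at h
    obtain ⟨rfl, h⟩ := h
    rcases List.append_eq_append_iff.1 h with ⟨t, rfl, ht⟩ | ⟨t, rfl, rfl⟩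
    · rcases t with _ | ⟨c, t⟩
      · simp only [List.nil_append] at ht
        subst ht
        have := Trivial.two (ihx x [] (by simp)) hy
        simpa using this
      · rw [List.cons_append, List.cons.injEq] at ht
        obtain ⟨rfl, rfl⟩ := ht
        have := Trivial.two hx (ihy t v rfl)
        simpa using this
    · have := Trivial.two (ihx u t rfl) hy
      simpa using this
  | @three x y z a b c hx hy hz ihx ihy ihz =>
    intro u v h
    rcases u with _ | ⟨d, u⟩
    · rw [List.nil_append] at h ⊢
      exact h ▸ hk _ _ (.three hx hy hz)
    rw [List.cons_append, List.cons_append, List.cons_append, List.cons.injEq] at h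
    obtain ⟨rfl, h⟩ := h
    rw [List.append_assoc] at h
    rcases List.append_eq_append_iff.1 h with ⟨t, rfl, ht⟩ | ⟨t, rfl, rfl⟩
    · rcases t with _ | ⟨d, t⟩
      · simp only [List.nil_append] at ht
        subst ht
        have := Trivial.three (ihx x [] (by simp)) hy hz
        simpa using this
      · rw [List.cons_append, List.cons_append, List.cons.injEq] at ht
        obtain ⟨rfl, ht⟩ := ht
        rcases List.append_eq_append_iff.1 ht with ⟨s, rfl, hs⟩ | ⟨s, rfl, rfl⟩
        · rcases s with _ | ⟨d, s⟩
          · simp only [List.nil_append] at hs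
            subst hs
            have := Trivial.three hx (ihy y [] (by simp)) hz
            simpa using this
          · rw [List.cons_append, List.cons.injEq] at hs
            obtain ⟨rfl, rfl⟩ := hs
            have := Trivial.three hx hy (ihz s v rfl)
            simpa using this
        · have := Trivial.three hx (ihy t s rfl) hz
          simpa using this
    · have := Trivial.three (ihx u t rfl) hy hz
      simpa using this

theorem Trivial.two_append (w : List Bool) (a : Bool) (h : Trivial w a) :
    Trivial ([false, false] ++ w) (!a) := by
  simpa using Trivial.two .nil h

theorem Trivial.three_append (w : List Bool) (a : Bool) (h : Trivial w a) :
    Trivial ([true, true, true] ++ w) (!a) := by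
  simpa using Trivial.three .nil .nil h

/-- The element `1` or `-1`. -/
def sign (s : Bool) : SL(2, ℤ) := if s then -1 else 1

theorem sign_not (s : Bool) : sign (!s) = -sign s := by cases s <;> simp [sign]

/-- Deleting a factor `S²` or `(ST)³` shortens the word and flips the sign; the induction hypothesis
derives the rest and `Trivial.insert` puts the factor back. If there is no such factor, the word is
empty. -/
theorem trivial_of_eval (w : List Bool) (s : Bool) (h : eval w = sign s) : Trivial w s := by
  induction hn : w.length using Nat.strong_induction_on generalizing w s with
  | _ n ih =>
    subst hn
    have key : ∀ k u v : List Bool, w = u ++ k ++ v → eval k = -1 → k ≠ [] →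
        (∀ w a, Trivial w a → Trivial (k ++ w) (!a)) → Trivial w s := by
      intro k u v hw hk hk0 hkt
      have h' : eval (u ++ v) = sign (!s) := by
        rw [sign_not, ← h, hw]
        simp [hk]
      have hlen : (u ++ v).length < w.length := by
        have := List.length_pos_iff.2 hk0
        simp only [hw, List.length_append]
        omega
      have := (ih _ hlen (u ++ v) (!s) h' rfl).insert hkt u v rfl
      simpa [hw] using this
    by_cases h2 : [false, false] <:+: w
    · obtain ⟨u, v, huv⟩ := h2
      exact key _ u v huv.symm (by simpa using gen_false_sq) (by simp) Trivial.two_append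
    by_cases h3 : [true, true, true] <:+: w
    · obtain ⟨u, v, huv⟩ := h3
      exact key _ u v huv.symm (by simpa using gen_true_cube) (by simp) Trivial.three_append
    have hnil : w = [] := Reduced.eq_nil ⟨h2, h3⟩ (by cases s <;> simp [h, sign])
    subst hnil
    cases s
    · exact .nil
    · exact absurd h (by decide)

/-! ### Graphs labelled by words -/

/-- An edge of a graph whose vertices are natural numbers, labelled by a word. -/
abbrev Edge := ℕ × List Bool × ℕ

/-- `Run E q w s`: some path of the graph `E` from `q` to `s` is labelled by `w`. -/
inductive Run (E : List Edge) : ℕ → List Bool → ℕ → Prop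
  | nil (q : ℕ) : Run E q [] q
  | cons {q r s : ℕ} {u w : List Bool} : (q, u, r) ∈ E → Run E r w s → Run E q (u ++ w) s

theorem Run.single {E : List Edge} {q r : ℕ} {u : List Bool} (h : (q, u, r) ∈ E) : Run E q u r := by
  simpa using Run.cons h (.nil r)

theorem Run.trans {E : List Edge} {q r s : ℕ} {u v : List Bool} (h : Run E q u r)
    (h' : Run E r v s) : Run E q (u ++ v) s := by
  induction h with
  | nil => exact h'
  | cons he _ ih => rw [List.append_assoc]; exact .cons he (ih h')

theorem Run.mono {E E' : List Edge} (hE : E ⊆ E') {q s : ℕ} {w : List Bool} (h : Run E q w s) :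
    Run E' q w s := by
  induction h with
  | nil => exact .nil _
  | cons he _ ih => exact .cons (hE he) ih

/-- Paths become edge lists testable by list equality: the sources followed by the end must equal
the start followed by the targets. -/
theorem run_iff_exists_chain {E : List Edge} {q s : ℕ} {w : List Bool} :
    Run E q w s ↔ ∃ es : List Edge, (∀ e ∈ es, e ∈ E) ∧
      es.map (fun e => e.1) ++ [s] = q :: es.map (fun e => e.2.2) ∧
      es.flatMap (fun e => e.2.1) = w := by
  constructor
  · intro h
    induction h with
    | nil q => exact ⟨[], by simp⟩
    | @cons q r s u w he _ ih =>
      obtain ⟨es, h1, h2, h3⟩ := ih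
      refine ⟨(q, u, r) :: es, ?_, ?_, ?_⟩
      · simpa using ⟨he, fun a b c h => h1 _ h⟩
      · simpa using h2
      · simpa using h3
  · rintro ⟨es, h1, h2, rfl⟩
    induction es generalizing q with
    | nil =>
      simp only [List.map_nil, List.nil_append, List.cons.injEq, and_true] at h2
      subst h2
      exact .nil _
    | cons e es ih =>
      simp only [List.map_cons, List.cons_append, List.cons.injEq] at h2
      obtain ⟨rfl, h2⟩ := h2
      exact .cons (h1 e (by simp)) (ih (fun e' he' => h1 e' (by simp [he'])) h2)

/-- A vertex to be reached after a word that remains to be read. -/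
abbrev Config := ℕ × List Bool

/-- `Trace E c w c'`: the graph leads from `c` to `c'` reading `w`. -/
inductive Trace (E : List Edge) : Config → List Bool → Config → Prop
  | refl (c : Config) : Trace E c [] c
  | move {q r : ℕ} {u w : List Bool} {c : Config} :
      (q, u, r) ∈ E → Trace E (r, u) w c → Trace E (q, []) w c
  | read {r : ℕ} {a : Bool} {u w : List Bool} {c : Config} :
      Trace E (r, u) w c → Trace E (r, a :: u) (a :: w) c

theorem Trace.trans {E : List Edge} {c d e : Config} {u v : List Bool} (h : Trace E c u d)
    (h' : Trace E d v e) : Trace E c (u ++ v) e := by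
  induction h with
  | refl => exact h'
  | move he _ ih => exact .move he (ih h')
  | read _ ih => exact .read (ih h')

theorem Trace.append {E : List Edge} {r : ℕ} {w : List Bool} {c : Config}
    (h : Trace E (r, []) w c) (u : List Bool) : Trace E (r, u) (u ++ w) c := by
  induction u with
  | nil => exact h
  | cons a u ih => exact .read ih

theorem Run.trace {E : List Edge} {q s : ℕ} {w : List Bool} (h : Run E q w s) :
    Trace E (q, []) w (s, []) := by
  induction h with
  | nil => exact .refl _
  | cons he _ ih => exact .move he (ih.append _)

theorem Trace.run {E : List Edge} {c d : Config} {w : List Bool} (h : Trace E c w d)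
    (hd : d.2 = []) : ∃ v, w = c.2 ++ v ∧ Run E c.1 v d.1 := by
  induction h with
  | refl c => exact ⟨[], by simp [hd], .nil _⟩
  | move he _ ih =>
    obtain ⟨v, rfl, hv⟩ := ih hd
    exact ⟨_, rfl, .cons he hv⟩
  | read _ ih =>
    obtain ⟨v, rfl, hv⟩ := ih hd
    exact ⟨v, rfl, hv⟩

theorem run_iff_trace {E : List Edge} {q s : ℕ} {w : List Bool} :
    Run E q w s ↔ Trace E (q, []) w (s, []) := by
  refine ⟨Run.trace, fun h => ?_⟩
  obtain ⟨v, rfl, hv⟩ := h.run rfl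
  exact hv

/-- Configurations stop inside an edge label, so a trace can be cut at any letter, even where a
grammar rule splits a label. -/
theorem Trace.split {E : List Edge} {c d : Config} {w : List Bool} (h : Trace E c w d) :
    ∀ (u : List Bool) (a : Bool) (v : List Bool), w = u ++ a :: v →
      ∃ q x, Trace E c u (q, a :: x) ∧ Trace E (q, x) v d := by
  induction h with
  | refl => intro u a v h; simp at h
  | move he _ ih =>
    intro u a v h
    obtain ⟨q, x, h1, h2⟩ := ih u a v h
    exact ⟨q, x, .move he h1, h2⟩
  | @read r b y w c ht ih =>
    intro u a v h
    rcases u with _ | ⟨b', u⟩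
    · rw [List.nil_append, List.cons.injEq] at h
      obtain ⟨rfl, rfl⟩ := h
      exact ⟨r, y, .refl _, ht⟩
    · rw [List.cons_append, List.cons.injEq] at h
      obtain ⟨rfl, h⟩ := h
      obtain ⟨q, x, h1, h2⟩ := ih u a v h
      exact ⟨q, x, .read h1, h2⟩

/-! ### Closed sets of triples -/

/-- The rules that generate the triples `(c, s, c')` such that the graph leads from `c` to `c'`
reading a word of value `1` or `-1`, according to `s`. -/
structure Closed (E : List Edge) (D : List (Config × Bool × Config)) : Prop where
  start : ((0, []), false, (0, [])) ∈ D
  move : ∀ d ∈ D, ∀ e ∈ E, d.2.2 = (e.1, []) → (d.1, d.2.1, (e.2.2, e.2.1)) ∈ D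
  refl : ∀ d ∈ D, d.2.2.2 ≠ [] →
    ((d.2.2.1, d.2.2.2.tail), false, (d.2.2.1, d.2.2.2.tail)) ∈ D
  two : ∀ d ∈ D, ∀ d' ∈ D, d.2.2 = (d'.1.1, false :: d'.1.2) → d'.2.2.2.head? = some false →
    (d.1, !(d.2.1 ^^ d'.2.1), (d'.2.2.1, d'.2.2.2.tail)) ∈ D
  three : ∀ d ∈ D, ∀ d' ∈ D, ∀ d'' ∈ D, d.2.2 = (d'.1.1, true :: d'.1.2) →
    d'.2.2 = (d''.1.1, true :: d''.1.2) → d''.2.2.2.head? = some true →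
    (d.1, !(d.2.1 ^^ d'.2.1 ^^ d''.2.1), (d''.2.2.1, d''.2.2.2.tail)) ∈ D

theorem Closed.mem_of_trace_nil {E : List Edge} {D : List (Config × Bool × Config)}
    (hD : Closed E D) {c₀ c c' : Config} {s : Bool} {w : List Bool} (h : Trace E c w c')
    (hw : w = []) (hc : (c₀, s, c) ∈ D) : (c₀, s, c') ∈ D := by
  induction h with
  | refl => exact hc
  | move he _ ih => exact ih hw (hD.move _ hc _ he rfl)
  | read => cases hw

/-- Completeness of the rules, by induction on the grammar. Carrying a triple already derived from
`c₀` avoids a concatenation rule: inner factors start afresh from `Closed.refl`, and `two` or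
`three` attaches them to what precedes. -/
theorem Closed.mem_of_trace {E : List Edge} {D : List (Config × Bool × Config)}
    (hD : Closed E D) {w : List Bool} {a : Bool} (hw : Trivial w a) :
    ∀ {c₀ c c' : Config} {s : Bool}, (c₀, s, c) ∈ D → Trace E c w c' → (c₀, s ^^ a, c') ∈ D := by
  induction hw with
  | nil =>
    intro c₀ c c' s hc h
    simpa using hD.mem_of_trace_nil h rfl hc
  | @two u v a b _ _ ihu ihv =>
    intro c₀ c c' s hc h
    obtain ⟨q₁, x₁, h₁, h⟩ := h.split [] false (u ++ false :: v) rfl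
    obtain ⟨q₂, x₂, h₂, h⟩ := h.split u false v rfl
    have m₁ := hD.mem_of_trace_nil h₁ rfl hc
    have m₂ := ihu (hD.refl _ m₁ (by simp)) h₂
    have m₃ := ihv (hD.two _ m₁ _ m₂ rfl rfl) h
    convert m₃ using 3
    cases s <;> cases a <;> cases b <;> rfl
  | @three u v w a b a' _ _ _ ihu ihv ihw =>
    intro c₀ c c' s hc h
    obtain ⟨q₁, x₁, h₁, h⟩ := h.split [] true (u ++ true :: (v ++ true :: w)) (by simp)
    obtain ⟨q₂, x₂, h₂, h⟩ := h.split u true (v ++ true :: w) rfl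
    obtain ⟨q₃, x₃, h₃, h⟩ := h.split v true w rfl
    have m₁ := hD.mem_of_trace_nil h₁ rfl hc
    have m₂ := ihu (hD.refl _ m₁ (by simp)) h₂
    have m₃ := ihv (hD.refl _ m₂ (by simp)) h₃
    have m₄ := ihw (hD.three _ m₁ _ m₂ _ m₃ rfl rfl rfl) h
    convert m₄ using 3
    cases s <;> cases a <;> cases b <;> cases a' <;> rfl

/-- The configurations that may occur on a path from the vertex `0`. -/
def configs (E : List Edge) : List Config :=
  (0, []) :: E.flatMap fun e => e.2.1.tails.map fun u => (e.2.2, u)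

theorem mem_configs_of_edge {E : List Edge} {e : Edge} (he : e ∈ E) :
    (e.2.2, e.2.1) ∈ configs E := by
  refine List.mem_cons_of_mem _ (List.mem_flatMap.2 ⟨e, he, List.mem_map.2 ⟨e.2.1, ?_, rfl⟩⟩)
  simp

theorem mem_configs_tail {E : List Edge} {c : Config} (hc : c ∈ configs E) :
    (c.1, c.2.tail) ∈ configs E := by
  rcases List.mem_cons.1 hc with rfl | hc
  · simp [configs]
  · obtain ⟨e, he, hu⟩ := List.mem_flatMap.1 hc
    obtain ⟨u, hu', rfl⟩ := List.mem_map.1 hu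
    refine List.mem_cons_of_mem _ (List.mem_flatMap.2 ⟨e, he, List.mem_map.2 ⟨u.tail, ?_, rfl⟩⟩)
    rw [List.mem_tails] at hu' ⊢
    exact (List.tail_suffix u).trans hu'

theorem eq_cons_tail_of_head? {α : Type} {a : α} {l : List α} (h : l.head? = some a) :
    l = a :: l.tail := by
  cases l <;> simp_all

theorem sign_mul (s t : Bool) : sign s * sign t = sign (s ^^ t) := by
  cases s <;> cases t <;> simp [sign]

/-- Soundness of the rule `two`: signs are central and `S² = -1`. -/
theorem Trace.two {E : List Edge} {c d d' e : Config} {u v : List Bool} {s t : Bool}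
    (h : Trace E c u d) (hu : eval u = sign s) (hd : d = (d'.1, false :: d'.2))
    (h' : Trace E d' v e) (hv : eval v = sign t) (he : e.2.head? = some false) :
    ∃ w, Trace E c w (e.1, e.2.tail) ∧ eval w = sign (!(s ^^ t)) := by
  subst hd
  obtain ⟨q, x⟩ := e
  have hx : x = false :: x.tail := eq_cons_tail_of_head? he
  rw [hx] at h'
  refine ⟨u ++ (false :: (v ++ [false])), h.trans (.read (h'.trans (.read (.refl _)))), ?_⟩
  have hc : gen false * sign t = sign t * gen false := by cases t <;> simp [sign]
  simp only [eval_append, eval_cons, eval_nil, mul_one, hu, hv, sign_not]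
  rw [← mul_assoc (gen false), hc, mul_assoc (sign t), gen_false_sq, ← mul_assoc, sign_mul]
  simp

theorem Trace.three {E : List Edge} {c d d' e e' f : Config} {u v w : List Bool} {s t r : Bool}
    (h : Trace E c u d) (hu : eval u = sign s) (hd : d = (d'.1, true :: d'.2))
    (h' : Trace E d' v e) (hv : eval v = sign t) (he : e = (e'.1, true :: e'.2))
    (h'' : Trace E e' w f) (hw : eval w = sign r) (hf : f.2.head? = some true) :
    ∃ w, Trace E c w (f.1, f.2.tail) ∧ eval w = sign (!(s ^^ t ^^ r)) := by
  subst hd he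
  obtain ⟨q, x⟩ := f
  have hx : x = true :: x.tail := eq_cons_tail_of_head? hf
  rw [hx] at h''
  refine ⟨u ++ (true :: (v ++ (true :: (w ++ [true])))),
    h.trans (.read (h'.trans (.read (h''.trans (.read (.refl _)))))), ?_⟩
  have hc : ∀ t, gen true * sign t = sign t * gen true := by intro t; cases t <;> simp [sign]
  simp only [eval_append, eval_cons, eval_nil, mul_one, hu, hv, hw, sign_not]
  rw [← mul_assoc (gen true) (sign r), hc, mul_assoc (sign r), ← mul_assoc (gen true) (sign t), hc,
    mul_assoc (sign t), ← mul_assoc (gen true) (sign r), hc, mul_assoc (sign r), gen_true_cube,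
    ← mul_assoc, ← mul_assoc, sign_mul, sign_mul]
  simp

/-- Some path from `0` to `1` is labelled by a word of value `1`. -/
def IdentityPath (E : List Edge) : Prop := ∃ w, Run E 0 w 1 ∧ eval w = 1

/-- If no path exists, all true triples between the finitely many configurations in `configs E` form
a closed set. Conversely every closed set contains all true triples that start at `(0, [])`. -/
theorem not_identityPath_iff (E : List Edge) :
    ¬ IdentityPath E ↔ ∃ D, Closed E D ∧ ((0, []), false, (1, [])) ∉ D := by
  constructor
  · intro hE
    classical
    have hmem : ∀ d : Config × Bool × Config, d ∈ ((configs E ×ˢ ([false, true] ×ˢ configs E)).filter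
        fun d => ∃ w, Trace E d.1 w d.2.2 ∧ eval w = sign d.2.1) ↔
        d.1 ∈ configs E ∧ d.2.2 ∈ configs E ∧
          ∃ w, Trace E d.1 w d.2.2 ∧ eval w = sign d.2.1 := by
      rintro ⟨c, s, c'⟩
      have : s ∈ [false, true] := by cases s <;> simp
      simp only [List.mem_filter, List.mem_product, this, true_and, decide_eq_true_eq, and_assoc]
    refine ⟨(configs E ×ˢ ([false, true] ×ˢ configs E)).filter
      fun d => ∃ w, Trace E d.1 w d.2.2 ∧ eval w = sign d.2.1, ?_, ?_⟩
    · refine ⟨?_, ?_, ?_, ?_, ?_⟩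
      · exact (hmem _).2 ⟨by simp [configs], by simp [configs], [], .refl _, rfl⟩
      · intro d hd e he hde
        obtain ⟨h1, h2, w, hw, hs⟩ := (hmem _).1 hd
        refine (hmem _).2 ⟨h1, mem_configs_of_edge he, w, ?_, hs⟩
        rw [hde] at hw
        simpa using hw.trans (.move (show (e.1, e.2.1, e.2.2) ∈ E from he) (.refl _))
      · intro d hd _
        obtain ⟨h1, h2, -⟩ := (hmem _).1 hd
        exact (hmem _).2 ⟨mem_configs_tail h2, mem_configs_tail h2, [], .refl _, rfl⟩
      · intro d hd d' hd' h h'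
        obtain ⟨h1, h2, w, hw, hs⟩ := (hmem _).1 hd
        obtain ⟨h1', h2', w', hw', hs'⟩ := (hmem _).1 hd'
        exact (hmem _).2 ⟨h1, mem_configs_tail h2', hw.two hs h hw' hs' h'⟩
      · intro d hd d' hd' d'' hd'' h h' h''
        obtain ⟨h1, h2, w, hw, hs⟩ := (hmem _).1 hd
        obtain ⟨h1', h2', w', hw', hs'⟩ := (hmem _).1 hd'
        obtain ⟨h1'', h2'', w'', hw'', hs''⟩ := (hmem _).1 hd''
        exact (hmem _).2 ⟨h1, mem_configs_tail h2'', hw.three hs h hw' hs' h' hw'' hs'' h''⟩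
    · intro hm
      obtain ⟨-, -, w, hw, hs⟩ := (hmem _).1 hm
      exact hE ⟨w, run_iff_trace.2 hw, hs⟩
  · rintro ⟨D, hD, h1⟩ ⟨w, hw, hw1⟩
    exact h1 (hD.mem_of_trace (trivial_of_eval w false hw1) hD.start hw.trace)

/-! ### Decidability of the identity path problem -/

theorem primrecRel_closed : PrimrecRel Closed := by
  have hE : ∀ {α : Type} [Primcodable α] {β : Type} [Primcodable β] {f g : α → β},
    Primrec f → Primrec g → PrimrecPred fun a => f a = g a := fun hf hg => Primrec.eq.comp hf hg
  have h : PrimrecPred fun p : List Edge × List (Config × Bool × Config) =>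
      ((0, []), false, (0, [])) ∈ p.2 ∧
      (∀ d ∈ p.2, ∀ e ∈ p.1, d.2.2 = (e.1, []) → (d.1, d.2.1, (e.2.2, e.2.1)) ∈ p.2) ∧
      (∀ d ∈ p.2, ¬ d.2.2.2 = [] →
        ((d.2.2.1, d.2.2.2.tail), false, (d.2.2.1, d.2.2.2.tail)) ∈ p.2) ∧
      (∀ d ∈ p.2, ∀ d' ∈ p.2, d.2.2 = (d'.1.1, false :: d'.1.2) → d'.2.2.2.head? = some false →
        (d.1, !(d.2.1 ^^ d'.2.1), (d'.2.2.1, d'.2.2.2.tail)) ∈ p.2) ∧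
      (∀ d ∈ p.2, ∀ d' ∈ p.2, ∀ d'' ∈ p.2, d.2.2 = (d'.1.1, true :: d'.1.2) →
        d'.2.2 = (d''.1.1, true :: d''.1.2) → d''.2.2.2.head? = some true →
        (d.1, !(d.2.1 ^^ d'.2.1 ^^ d''.2.1), (d''.2.2.1, d''.2.2.2.tail)) ∈ p.2) := by
    refine .and ?_ (.and ?_ (.and ?_ (.and ?_ ?_)))
    · exact primrecPred_mem (by fun_prop) (by fun_prop)
    · refine primrecPred_forall_mem (by fun_prop) (primrecPred_forall_mem (by fun_prop)
        (primrecPred_imp (hE ?_ ?_) (primrecPred_mem ?_ ?_))) <;> fun_prop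
    · refine primrecPred_forall_mem (by fun_prop)
        (primrecPred_imp (.not (hE ?_ ?_)) (primrecPred_mem ?_ ?_)) <;> fun_prop
    · refine primrecPred_forall_mem (by fun_prop) (primrecPred_forall_mem (by fun_prop)
        (primrecPred_imp (hE ?_ ?_) (primrecPred_imp (hE ?_ ?_) (primrecPred_mem ?_ ?_))))
        <;> fun_prop
    · refine primrecPred_forall_mem (by fun_prop) (primrecPred_forall_mem (by fun_prop)
        (primrecPred_forall_mem (by fun_prop)
        (primrecPred_imp (hE ?_ ?_) (primrecPred_imp (hE ?_ ?_) (primrecPred_imp (hE ?_ ?_)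
          (primrecPred_mem ?_ ?_))))))
        <;> fun_prop
  refine PrimrecPred.of_eq h ?_
  rintro ⟨E, D⟩
  exact ⟨fun ⟨h1, h2, h3, h4, h5⟩ => ⟨h1, h2, h3, h4, h5⟩,
    fun ⟨h1, h2, h3, h4, h5⟩ => ⟨h1, h2, h3, h4, h5⟩⟩

@[fun_prop]
theorem primrec_act {α : Type} [Primcodable α] {f : α → List Bool} {g : α → ℤ × ℤ}
    (hf : Primrec f) (hg : Primrec g) : Primrec fun a => act (f a) (g a) := by
  have h : Primrec₂ genAct := by
    refine Primrec.of_eq (f := fun p : Bool × (ℤ × ℤ) => (-p.2.2, bif p.1 then p.2.1 + p.2.2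
      else p.2.1)) ?_ ?_
    · refine Primrec.pair (by fun_prop) (Primrec.cond ?_ ?_ ?_) <;> fun_prop
    · rintro ⟨a, v⟩
      cases a <;> rfl
  exact Primrec.list_foldr hf hg
    (h.comp (Primrec.fst.comp Primrec.snd) (Primrec.snd.comp Primrec.snd)).to₂

/-- The entries of the value of a word, row by row. -/
def entries (w : List Bool) : (ℤ × ℤ) × (ℤ × ℤ) :=
  (((act w (1, 0)).1, (act w (0, 1)).1), ((act w (1, 0)).2, (act w (0, 1)).2))

/-- The columns of the matrix are the images of the basis vectors, so values of words can be
compared as coded integer data. -/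
theorem entries_eq (w : List Bool) : entries w = encMat (eval w) := by
  simp [entries, encMat, act_eq_apply, apply]

theorem encMat_injective : Function.Injective encMat := by
  intro M N h
  simp only [encMat, Prod.mk.injEq] at h
  obtain ⟨⟨h1, h2⟩, h3, h4⟩ := h
  ext i j
  fin_cases i <;> fin_cases j <;> assumption

@[fun_prop]
theorem primrec_entries {α : Type} [Primcodable α] {f : α → List Bool} (hf : Primrec f) :
    Primrec fun a => entries (f a) := by
  unfold entries
  fun_prop

theorem computablePred_identityPath : ComputablePred IdentityPath := by
  refine computablePred_of_certificates (α := List Edge)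
    (A := fun E es => (∀ e ∈ es, e ∈ E) ∧
      es.map (fun e => e.1) ++ [1] = 0 :: es.map (fun e => e.2.2) ∧
      entries (es.flatMap (fun e => e.2.1)) = entries [])
    (B := fun E D => Closed E D ∧ ¬ ((0, []), false, (1, [])) ∈ D) ?_ ?_ ?_ ?_
  · refine PrimrecPred.and (primrecPred_forall_mem (by fun_prop) (primrecPred_mem ?_ ?_))
      (.and (Primrec.eq.comp ?_ ?_) (Primrec.eq.comp ?_ ?_)) <;> fun_prop
  · exact primrecRel_closed.and (.not (primrecPred_mem (by fun_prop) (by fun_prop)))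
  · intro E
    simp only [IdentityPath, run_iff_exists_chain]
    constructor
    · rintro ⟨w, ⟨es, h1, h2, rfl⟩, hw⟩
      exact ⟨es, h1, h2, by rw [entries_eq, hw, entries_eq, eval_nil]⟩
    · rintro ⟨es, h1, h2, h3⟩
      refine ⟨_, ⟨es, h1, h2, rfl⟩, ?_⟩
      rw [entries_eq, entries_eq] at h3
      exact encMat_injective h3
  · exact not_identityPath_iff

/-! ### Reachability of vectors -/

/-- With (a, b) = g (a', b') and s a' + t b' = 1, the matrix with rows (s, t) and (-b', a') has
determinant 1 and sends (a, b) to (g, 0). -/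
theorem exists_act_eq_natCast (v : ℤ × ℤ) : ∃ (w : List Bool) (d : ℕ), act w v = ((d : ℤ), 0) := by
  obtain ⟨a, b⟩ := v
  rcases eq_or_ne (Int.gcd a b) 0 with h0 | h0
  · rw [Int.gcd_eq_zero_iff] at h0
    exact ⟨[], 0, by simp [h0]⟩
  obtain ⟨a', ha⟩ := Int.gcd_dvd_left a b
  obtain ⟨b', hb⟩ := Int.gcd_dvd_right a b
  have hbez := Int.gcd_eq_gcd_ab a b
  have hg : (Int.gcd a b : ℤ) ≠ 0 := by exact_mod_cast h0
  generalize (Int.gcd a b) = g at *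
  generalize Int.gcdA a b = s at *
  generalize Int.gcdB a b = t at *
  subst ha hb
  have h1 : a' * s + b' * t = 1 := by
    apply mul_left_cancel₀ hg
    linear_combination -hbez
  obtain ⟨w, hw⟩ := exists_eval_eq ⟨!![s, t; -b', a'], by
    rw [Matrix.det_fin_two_of]; linear_combination h1⟩
  refine ⟨w, g, ?_⟩
  rw [act_eq_apply, hw]
  simp only [apply, Matrix.of_apply, Matrix.cons_val', Matrix.cons_val_zero, Matrix.cons_val_one,
    Matrix.cons_val_fin_one, Prod.mk.injEq]
  exact ⟨by linear_combination (g : ℤ) * h1, by ring⟩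

theorem exists_computable_normalForm : ∃ f : ℤ × ℤ → List Bool × ℕ, Computable f ∧
    ∀ v, act (f v).1 v = (((f v).2 : ℤ), 0) := by
  refine exists_computable_of_search
    (R := fun (v : ℤ × ℤ) (k : List Bool × ℕ) => act k.1 v = ((k.2 : ℤ), 0))
    (Primrec.eq.comp (by fun_prop) (by fun_prop)) fun v => ?_
  obtain ⟨w, d, h⟩ := exists_act_eq_natCast v
  exact ⟨(w, d), h⟩

/-- If `d ≠ 0` the lower left entry vanishes, so the diagonal entries are ±1, and non-negativity
settles the sign. -/
theorem apply_natCast_eq {M : SL(2, ℤ)} {d d' : ℕ} (h : apply M ((d : ℤ), 0) = ((d' : ℤ), 0)) :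
    d = d' := by
  have hdet := M.det_coe
  rw [Matrix.det_fin_two] at hdet
  simp only [apply, mul_zero, add_zero, Prod.mk.injEq] at h
  rcases eq_or_ne d 0 with rfl | hd
  · have := h.1; simp at this; omega
  have hc : M 1 0 = 0 := by
    rcases mul_eq_zero.1 h.2 with h | h
    · exact h
    · exact absurd (by exact_mod_cast h) hd
  rw [hc, mul_zero, sub_zero] at hdet
  rcases Int.eq_one_or_neg_one_of_mul_eq_one hdet with h1 | h1 <;> rw [h1] at h <;> omega

theorem eq_T_zpow {M : SL(2, ℤ)} {d : ℕ} (hd : d ≠ 0) (h : apply M ((d : ℤ), 0) = ((d : ℤ), 0)) :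
    M = ModularGroup.T ^ M 0 1 := by
  have hdet := M.det_coe
  rw [Matrix.det_fin_two] at hdet
  simp only [apply, mul_zero, add_zero, Prod.mk.injEq] at h
  have hd' : (d : ℤ) ≠ 0 := by exact_mod_cast hd
  have hc : M 1 0 = 0 := (mul_eq_zero.1 h.2).resolve_right hd'
  have ha : M 0 0 = 1 := mul_right_cancel₀ hd' (by rw [h.1, one_mul])
  rw [hc, mul_zero, sub_zero, ha, one_mul] at hdet
  refine Subtype.ext ?_
  rw [ModularGroup.coe_T_zpow]
  ext i j
  fin_cases i <;> fin_cases j <;> simp [hc, ha, hdet]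

/-- A word of value `T`. -/
def wordT : List Bool := [false, false, false, true]

/-- `S³ * (S * T) = T`, since `S` has order 4. -/
theorem eval_wordT : eval wordT = ModularGroup.T := by decide

/-- Words whose values generate the stabilizer of `(d, 0)`. -/
def loopWords (d : ℕ) : List (List Bool) :=
  if d = 0 then [[false], [true]] else [wordT, invWord wordT]

theorem apply_T (d : ℕ) : apply ModularGroup.T ((d : ℤ), 0) = ((d : ℤ), 0) := by
  simp [apply, ModularGroup.coe_T]

theorem apply_zero (M : SL(2, ℤ)) : apply M (0, 0) = (0, 0) := by simp [apply]

theorem apply_eval_loopWords {d : ℕ} {u : List Bool} (hu : u ∈ loopWords d) :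
    apply (eval u) ((d : ℤ), 0) = ((d : ℤ), 0) := by
  rw [loopWords] at hu
  split_ifs at hu with hd
  · rw [hd, Nat.cast_zero, apply_zero]
  · simp only [List.mem_cons, List.not_mem_nil, or_false] at hu
    rcases hu with rfl | rfl
    · rw [eval_wordT, apply_T]
    · rw [eval_invWord, eval_wordT, eq_comm, ← apply_eq_iff, apply_T]

/-- The values of the closed paths at a vertex. -/
def loopSubmonoid (E : List Edge) (q : ℕ) : Submonoid SL(2, ℤ) where
  carrier := {g | ∃ w, Run E q w q ∧ eval w = g}
  one_mem' := ⟨[], .nil q, rfl⟩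
  mul_mem' := by
    rintro _ _ ⟨u, hu, rfl⟩ ⟨v, hv, rfl⟩
    exact ⟨u ++ v, hu.trans hv, eval_append u v⟩

theorem mem_loopSubmonoid {E : List Edge} {q d : ℕ} (hE : ∀ u ∈ loopWords d, (q, u, q) ∈ E)
    {K : SL(2, ℤ)} (hK : apply K ((d : ℤ), 0) = ((d : ℤ), 0)) : K ∈ loopSubmonoid E q := by
  have hmem : ∀ u ∈ loopWords d, eval u ∈ loopSubmonoid E q :=
    fun u hu => ⟨u, .single (hE u hu), rfl⟩
  by_cases hd : d = 0
  · obtain ⟨w, rfl⟩ := exists_eval_eq K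
    refine Submonoid.list_prod_mem _ fun g hg => ?_
    obtain ⟨a, -, rfl⟩ := List.mem_map.1 hg
    simpa using hmem [a] (by cases a <;> simp [loopWords, hd])
  · have hT : ModularGroup.T ∈ loopSubmonoid E q :=
      eval_wordT ▸ hmem wordT (by simp [loopWords, hd])
    have hT_inv : ModularGroup.T⁻¹ ∈ loopSubmonoid E q := by
      have := hmem (invWord wordT) (by simp [loopWords, hd])
      rwa [eval_invWord, eval_wordT] at this
    rw [eq_T_zpow hd hK]
    rcases Int.eq_nat_or_neg (K 0 1) with ⟨n, hn | hn⟩ <;> rw [hn]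
    · rw [zpow_natCast]
      exact pow_mem hT n
    · rw [zpow_neg, zpow_natCast, ← inv_pow]
      exact pow_mem hT_inv n

/-- A graph, initial and final vertices, and two vectors. -/
abbrev VectorInput := List Edge × List ℕ × List ℕ × (ℤ × ℤ) × (ℤ × ℤ)

/-- Some path of the graph from an initial to a final vertex leads the first vector to the
second. -/
def VectorPath (p : VectorInput) : Prop :=
  ∃ s ∈ p.2.1, ∃ t ∈ p.2.2.1, ∃ w, Run p.1 s w t ∧ act w p.2.2.2.1 = p.2.2.2.2

/-- The graph that reduces `VectorPath` to `IdentityPath`, where `a` and `b` bring the two vectors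
to normal form. -/
def vectorGraph (p : VectorInput) (a b : List Bool × ℕ) : List Edge :=
  p.2.1.map (fun s => (0, [], s + 3)) ++
    (p.1.map (fun e => (e.1 + 3, e.2.1, e.2.2 + 3)) ++
    (p.2.2.1.map (fun t => (t + 3, invWord a.1, 2)) ++
    ((loopWords a.2).map (fun u => (2, u, 2)) ++
    if a.2 = b.2 then [(2, b.1, 1)] else [])))

theorem mem_vectorGraph {p : VectorInput} {a b : List Bool × ℕ} {e : Edge} :
    e ∈ vectorGraph p a b ↔ (∃ s ∈ p.2.1, e = (0, [], s + 3)) ∨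
      (∃ e' ∈ p.1, e = (e'.1 + 3, e'.2.1, e'.2.2 + 3)) ∨
      (∃ t ∈ p.2.2.1, e = (t + 3, invWord a.1, 2)) ∨ (∃ u ∈ loopWords a.2, e = (2, u, 2)) ∨
      (a.2 = b.2 ∧ e = (2, b.1, 1)) := by
  have h : e ∈ (if a.2 = b.2 then [((2, b.1, 1) : Edge)] else []) ↔
      (a.2 = b.2 ∧ e = (2, b.1, 1)) := by
    split_ifs with h <;> simp [h]
  simp only [vectorGraph, List.mem_append, List.mem_map, h, eq_comm (b := e)]

/-- What a path of `vectorGraph` from the given vertex to the vertex `1` does with the second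
vector. -/
def LeadsBack (p : VectorInput) (a : List Bool × ℕ) (w : List Bool) : ℕ → Prop
  | 0 => ∃ s ∈ p.2.1, ∃ t ∈ p.2.2.1, ∃ u, Run p.1 s u t ∧ act w p.2.2.2.2 = act u p.2.2.2.1
  | 1 => act w p.2.2.2.2 = p.2.2.2.2
  | 2 => act w p.2.2.2.2 = ((a.2 : ℤ), 0)
  | s + 3 => ∃ t ∈ p.2.2.1, ∃ u, Run p.1 s u t ∧ act w p.2.2.2.2 = act u p.2.2.2.1

theorem act_append (u v : List Bool) (x : ℤ × ℤ) : act (u ++ v) x = act u (act v x) :=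
  List.foldr_append

theorem act_invWord_eq {w : List Bool} {u v : ℤ × ℤ} (h : act w u = v) : act (invWord w) v = u := by
  rw [act_eq_apply] at h ⊢
  rw [eval_invWord, eq_comm, ← apply_eq_iff, h]

/-- Labels act on the left, so the tail of a path acts first. Followed backwards from the vertex
`1`, the second vector goes to normal form, stays there during the loops, returns along `a⁻¹` to the
first vector, and is then moved by the original graph. -/
theorem leadsBack_of_run {p : VectorInput} {a b : List Bool × ℕ}
    (ha : act a.1 p.2.2.2.1 = ((a.2 : ℤ), 0)) (hb : act b.1 p.2.2.2.2 = ((b.2 : ℤ), 0))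
    {q r : ℕ} {w : List Bool} (h : Run (vectorGraph p a b) q w r) (hr : r = 1) :
    LeadsBack p a w q := by
  induction h with
  | nil q => subst hr; rfl
  | cons he _ ih =>
    have ih := ih hr
    rcases mem_vectorGraph.1 he with ⟨s, hs, he⟩ | ⟨e, he', he⟩ | ⟨t, ht, he⟩ | ⟨u, hu, he⟩ |
      ⟨hab, he⟩ <;> simp only [Prod.mk.injEq] at he <;> obtain ⟨rfl, rfl, rfl⟩ := he
    · obtain ⟨t, ht, u, hu, hw⟩ := ih
      exact ⟨s, hs, t, ht, u, hu, hw⟩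
    · obtain ⟨t, ht, u, hu, hw⟩ := ih
      exact ⟨t, ht, e.2.1 ++ u, .cons he' hu, by rw [act_append, act_append, hw]⟩
    · refine ⟨t, ht, [], .nil t, ?_⟩
      rw [act_append, show act _ _ = _ from ih, act_invWord_eq ha, act_nil]
    · change act _ _ = _
      rw [act_append, show act _ _ = _ from ih, act_eq_apply, apply_eval_loopWords hu]
    · change act _ _ = _
      rw [act_append, show act _ _ = _ from ih, hb, hab]

theorem Run.lift {p : VectorInput} (a b : List Bool × ℕ) {s t : ℕ} {u : List Bool}
    (h : Run p.1 s u t) : Run (vectorGraph p a b) (s + 3) u (t + 3) := by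
  induction h with
  | nil => exact .nil _
  | cons he _ ih => exact .cons (mem_vectorGraph.2 (.inr (.inl ⟨_, he, rfl⟩))) ih

/-- The original vertices are shifted by 3 to free the start `0`, the end `1` and the vertex `2`
that carries the stabilizer loops. -/
theorem vectorPath_iff {p : VectorInput} {a b : List Bool × ℕ}
    (ha : act a.1 p.2.2.2.1 = ((a.2 : ℤ), 0)) (hb : act b.1 p.2.2.2.2 = ((b.2 : ℤ), 0)) :
    VectorPath p ↔ IdentityPath (vectorGraph p a b) := by
  constructor
  · rintro ⟨s, hs, t, ht, u, hu, hxy⟩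
    rw [act_eq_apply] at ha hb hxy
    -- K = A u⁻¹ B⁻¹ is forced by u A⁻¹ K B = 1; it carries one normal form to the other through y
    -- and x.
    have hK : apply (eval a.1 * ((eval u)⁻¹ * (eval b.1)⁻¹)) ((b.2 : ℤ), 0) = ((a.2 : ℤ), 0) := by
      rw [apply_mul, apply_mul, ← (apply_eq_iff _ _ _).1 hb, ← (apply_eq_iff _ _ _).1 hxy, ha]
    have hab := (apply_natCast_eq hK).symm
    rw [hab] at hK
    obtain ⟨k, hk, hkv⟩ := mem_loopSubmonoid (E := vectorGraph p a b) (q := 2)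
      (fun u hu => mem_vectorGraph.2 (.inr (.inr (.inr (.inl ⟨u, hab ▸ hu, rfl⟩))))) hK
    refine ⟨_, ((Run.single (mem_vectorGraph.2 (.inl ⟨s, hs, rfl⟩))).trans ((hu.lift a b).trans
      ((Run.single (mem_vectorGraph.2 (.inr (.inr (.inl ⟨t, ht, rfl⟩))))).trans (hk.trans
      (Run.single (mem_vectorGraph.2 (.inr (.inr (.inr (.inr ⟨hab, rfl⟩)))))))))), ?_⟩
    simp only [eval_append, eval_nil, eval_invWord, hkv]
    group
  · rintro ⟨w, hw, hw1⟩
    obtain ⟨s, hs, t, ht, u, hu, h⟩ := leadsBack_of_run ha hb hw rfl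
    rw [act_eq_apply w, hw1, apply_one] at h
    exact ⟨s, hs, t, ht, u, hu, h.symm⟩

@[fun_prop]
theorem primrec_invWord {α : Type} [Primcodable α] {f : α → List Bool} (hf : Primrec f) :
    Primrec fun a => invWord (f a) := by
  refine Primrec.of_eq (f := fun a => (f a).reverse.flatMap
    fun a => [a, a, a, a, a, a, a, a, a, a, a]) ?_ fun _ => rfl
  fun_prop

theorem primrec_vectorGraph : Primrec fun q : VectorInput × (List Bool × ℕ) × (List Bool × ℕ) =>
    vectorGraph q.1 q.2.1 q.2.2 := by
  have h1 : Primrec fun q : VectorInput × (List Bool × ℕ) × (List Bool × ℕ) =>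
      loopWords q.2.1.2 :=
    Primrec.ite (Primrec.eq.comp (by fun_prop) (by fun_prop)) (by fun_prop) (by fun_prop)
  have h2 : Primrec fun q : VectorInput × (List Bool × ℕ) × (List Bool × ℕ) =>
      if q.2.1.2 = q.2.2.2 then [((2, q.2.2.1, 1) : Edge)] else [] :=
    Primrec.ite (Primrec.eq.comp (by fun_prop) (by fun_prop)) (by fun_prop) (by fun_prop)
  unfold vectorGraph
  fun_prop

theorem computablePred_vectorPath : ComputablePred VectorPath := by
  obtain ⟨f, hf, hfv⟩ := exists_computable_normalForm
  have hg : Computable fun p : VectorInput => vectorGraph p (f p.2.2.2.1) (f p.2.2.2.2) := by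
    refine primrec_vectorGraph.to_comp.comp (Computable.id.pair (.pair ?_ ?_))
    · exact hf.comp (Primrec.to_comp (by fun_prop))
    · exact hf.comp (Primrec.to_comp (by fun_prop))
  exact (computablePred_identityPath.comp_computable hg).of_eq fun p =>
    (vectorPath_iff (hfv _) (hfv _)).symm

/-! ### From matrices to words -/

theorem exists_map_entries {mats : List ((ℤ × ℤ) × (ℤ × ℤ))}
    (h : ∀ m ∈ mats, m.1.1 * m.2.2 + -(m.1.2 * m.2.1) = 1) :
    ∃ ws : List (List Bool), ws.map entries = mats := by
  induction mats with
  | nil => exact ⟨[], rfl⟩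
  | cons m mats ih =>
    obtain ⟨ws, hws⟩ := ih fun m' hm' => h m' (by simp [hm'])
    obtain ⟨⟨a, b⟩, c, d⟩ := m
    obtain ⟨w, hw⟩ := exists_eval_eq ⟨!![a, b; c, d], by
      rw [Matrix.det_fin_two_of]
      have := h _ List.mem_cons_self
      linear_combination this⟩
    exact ⟨w :: ws, by simp [hws, entries_eq, hw, encMat]⟩

/-- Words for the matrices are found by search. The second alternative makes the search halt also on
data with a determinant other than 1, which code no input. -/
theorem exists_computable_words : ∃ f : List ((ℤ × ℤ) × (ℤ × ℤ)) → List (List Bool),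
    Computable f ∧ ∀ {n : ℕ} (M : Fin n → SL(2, ℤ)), (f (encMats M)).map eval = List.ofFn M := by
  obtain ⟨f, hf, hfv⟩ := exists_computable_of_search
    (R := fun (mats : List ((ℤ × ℤ) × (ℤ × ℤ))) (ws : List (List Bool)) =>
      ws.map entries = mats ∨ ∃ m ∈ mats, ¬ m.1.1 * m.2.2 + -(m.1.2 * m.2.1) = 1)
    (by
      refine .or (Primrec.eq.comp (by fun_prop) (by fun_prop))
        (primrecPred_exists_mem (by fun_prop) (.not (Primrec.eq.comp ?_ ?_))) <;> fun_prop)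
    (by
      intro mats
      by_cases h : ∀ m ∈ mats, m.1.1 * m.2.2 + -(m.1.2 * m.2.1) = 1
      · obtain ⟨ws, hws⟩ := exists_map_entries h
        exact ⟨ws, .inl hws⟩
      · push Not at h
        exact ⟨[], .inr h⟩)
  refine ⟨f, hf, fun {n} M => ?_⟩
  have h := (hfv (encMats M)).resolve_right (by
    rintro ⟨m, hm, hdet⟩
    obtain ⟨i, rfl⟩ := (List.mem_ofFn' _ _).1 hm
    have := (M i).det_coe
    rw [Matrix.det_fin_two] at this
    exact hdet (by simp only [encMat]; linear_combination this))
  refine List.map_injective_iff.2 encMat_injective ?_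
  rw [List.map_map, List.map_ofFn, ← funext (f := entries) (g := encMat ∘ eval) entries_eq, h]
  rfl

/-! ### Regular languages -/

/-- The graph problem of a generalized reachability problem. -/
def regularVectorInput (ws : List (List Bool)) (A : ℕ × List (ℕ × ℕ × ℕ) × List ℕ × List ℕ)
    (x y : ℤ × ℤ) : VectorInput :=
  (A.2.1.map fun t => (t.1, ws.getD t.2.1 [], t.2.2), A.2.2.1, A.2.2.2, x, y)

theorem mem_encSet {m : ℕ} {s : Set (Fin m)} {q : ℕ} :
    q ∈ encSet s ↔ ∃ i : Fin m, i ∈ s ∧ (i : ℕ) = q := by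
  simp [encSet, eq_comm]

theorem mem_encStep {n m : ℕ} {A : NFA (Fin n) (Fin m)} {t : ℕ × ℕ × ℕ} :
    t ∈ encStep A ↔ ∃ (q : Fin m) (a : Fin n) (r : Fin m), r ∈ A.step q a ∧
      t = ((q : ℕ), (a : ℕ), (r : ℕ)) := by
  simp only [encStep, List.mem_map, List.mem_filter, decide_eq_true_eq]
  constructor
  · rintro ⟨⟨q, a, r⟩, ⟨-, h⟩, rfl⟩
    exact ⟨q, a, r, h, rfl⟩
  · rintro ⟨q, a, r, h, rfl⟩
    refine ⟨(q, a, r), ⟨?_, h⟩, rfl⟩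
    exact List.mem_product.2 ⟨List.mem_finRange q,
      List.mem_product.2 ⟨List.mem_finRange a, List.mem_finRange r⟩⟩

/-- The default `[]` is never reached, because `ws` has length `n`. -/
theorem eval_getD {n : ℕ} {M : Fin n → SL(2, ℤ)} {ws : List (List Bool)}
    (hws : ws.map eval = List.ofFn M) (a : Fin n) : eval (ws.getD a []) = M a := by
  have hlen : ws.length = n := by simpa using congrArg List.length hws
  have h : (ws.map eval)[(a : ℕ)]? = (List.ofFn M)[(a : ℕ)]? := by rw [hws]
  have ha : (a : ℕ) < ws.length := hlen ▸ a.2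
  simpa [List.getD_eq_getElem _ _ ha, ha] using h

theorem vectorPath_regularVectorInput_iff {n m : ℕ} {M : Fin n → SL(2, ℤ)}
    {ws : List (List Bool)} (hws : ws.map eval = List.ofFn M) (A : NFA (Fin n) (Fin m))
    (x y : ℤ × ℤ) : VectorPath (regularVectorInput ws (encNFA A) x y) ↔
      ∃ w ∈ A.accepts, apply (w.map M).prod x = y := by
  set G := (regularVectorInput ws (encNFA A) x y).1 with hG
  have hedge : ∀ {e : Edge}, e ∈ G ↔ ∃ (q : Fin m) (a : Fin n) (r : Fin m), r ∈ A.step q a ∧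
      e = ((q : ℕ), ws.getD a [], (r : ℕ)) := by
    intro e
    simp only [hG, regularVectorInput, encNFA, List.mem_map, mem_encStep]
    constructor
    · rintro ⟨_, ⟨q, a, r, h, rfl⟩, rfl⟩
      exact ⟨q, a, r, h, rfl⟩
    · rintro ⟨q, a, r, h, rfl⟩
      exact ⟨_, ⟨q, a, r, h, rfl⟩, rfl⟩
  -- Vertices are plain naturals; a path that starts at a state of the automaton stays among its
  -- states.
  have hrun : ∀ {q r : ℕ} {u : List Bool}, Run G q u r → ∀ i : Fin m, q = i → ∃ (j : Fin m) (v : _),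
      r = j ∧ Nonempty (A.Path i j v) ∧ eval u = (v.map M).prod := by
    intro q r u h
    induction h with
    | nil q => exact fun i hi => ⟨i, [], hi, ⟨.nil i⟩, rfl⟩
    | cons he _ ih =>
      rintro i rfl
      obtain ⟨i', a, k, hk, he⟩ := hedge.1 he
      simp only [Prod.mk.injEq, Fin.val_inj] at he
      obtain ⟨rfl, rfl, rfl⟩ := he
      obtain ⟨j, v, rfl, ⟨hp⟩, hv⟩ := ih k rfl
      exact ⟨j, a :: v, rfl, ⟨.cons _ _ _ _ _ hk hp⟩, by
        rw [eval_append, eval_getD hws, hv, List.map_cons, List.prod_cons]⟩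
  have hpath : ∀ {i j : Fin m} {v : List (Fin n)}, A.Path i j v →
      ∃ u, Run G i u j ∧ eval u = (v.map M).prod := by
    intro i j v h
    induction h with
    | nil => exact ⟨[], .nil _, rfl⟩
    | cons k i j a v hk _ ih =>
      obtain ⟨u, hu, huv⟩ := ih
      exact ⟨_, .cons (hedge.2 ⟨i, a, k, hk, rfl⟩) hu, by
        rw [eval_append, eval_getD hws, huv, List.map_cons, List.prod_cons]⟩
  simp only [NFA.accepts_iff_exists_path]
  constructor
  · rintro ⟨s, hs, t, ht, u, hu, hxy⟩
    obtain ⟨i, hi, rfl⟩ := mem_encSet.1 hs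
    obtain ⟨j', hj', rfl⟩ := mem_encSet.1 ht
    obtain ⟨j, v, hj, hp, hv⟩ := hrun hu i rfl
    rw [Fin.val_inj] at hj
    subst hj
    refine ⟨v, ⟨i, hi, _, hj', hp⟩, ?_⟩
    rw [← hv, ← act_eq_apply]
    exact hxy
  · rintro ⟨v, ⟨i, hi, j, hj, ⟨hp⟩⟩, hxy⟩
    obtain ⟨u, hu, huv⟩ := hpath hp
    refine ⟨i, mem_encSet.2 ⟨i, hi, rfl⟩, j, mem_encSet.2 ⟨j, hj, rfl⟩, u, hu, ?_⟩
    rw [act_eq_apply, huv]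
    exact hxy

theorem primrec_regularVectorInput : Primrec fun c : List (List Bool) ×
    (ℕ × List (ℕ × ℕ × ℕ) × List ℕ × List ℕ) × (ℤ × ℤ) × (ℤ × ℤ) =>
      regularVectorInput c.1 c.2.1 c.2.2.1 c.2.2.2 := by
  unfold regularVectorInput
  fun_prop

theorem encVec_injective : Function.Injective encVec := by
  intro x y h
  simp only [encVec, Prod.mk.injEq] at h
  ext i
  fin_cases i
  exacts [h.1, h.2]

theorem computablePred_regularVectorInput {γ : Type} [Primcodable γ]
    {f : γ → List (List Bool)} (hf : Computable f)
    {g : γ → (ℕ × List (ℕ × ℕ × ℕ) × List ℕ × List ℕ) × (ℤ × ℤ) × (ℤ × ℤ)} (hg : Primrec g) :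
    ComputablePred fun c => VectorPath (regularVectorInput (f c) (g c).1 (g c).2.1 (g c).2.2) :=
  computablePred_vectorPath.comp_computable
    (primrec_regularVectorInput.to_comp.comp (hf.pair hg.to_comp))

theorem isDecidable_vectorReachable : IsDecidable (RegularInput.enc encVec) VectorReachable := by
  obtain ⟨f, hf, hfv⟩ := exists_computable_words
  refine ⟨fun c => VectorPath (regularVectorInput (f c.1) c.2.1 c.2.2.1 c.2.2.2),
    computablePred_regularVectorInput (hf.comp Computable.fst) (g := fun c => c.2)
      Primrec.snd, fun I => ?_⟩
  simp only [RegularInput.enc]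
  rw [vectorPath_regularVectorInput_iff (hfv I.M)]
  simp only [VectorReachable, apply_encVec, encVec_injective.eq_iff, RegularInput.lang,
    RegularInput.wordProd]

/-! ### Fractional linear maps -/

/-- The Bézout row (s, t) is replaced by (s, t) M⁻¹. -/
theorem isCoprime_apply (M : SL(2, ℤ)) {v : ℤ × ℤ} (hv : IsCoprime v.1 v.2) :
    IsCoprime (apply M v).1 (apply M v).2 := by
  obtain ⟨s, t, h⟩ := hv
  have hdet := M.det_coe
  rw [Matrix.det_fin_two] at hdet
  refine ⟨s * M 1 1 - t * M 1 0, t * M 0 0 - s * M 0 1, ?_⟩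
  simp only [apply]
  linear_combination (s * v.1 + t * v.2) * hdet + h

theorem div_eq_rat_iff {p q : ℤ} (h : IsCoprime p q) (hq : q ≠ 0) (y : ℚ) :
    (p : ℚ) / q = y ↔ (p, q) = (y.num, (y.den : ℤ)) ∨ (p, q) = (-y.num, -(y.den : ℤ)) := by
  have hden : (0 : ℤ) < y.den := by exact_mod_cast y.den_pos
  have hy : (y.num : ℚ) / ((y.den : ℤ) : ℚ) = y := by
    rw [Int.cast_natCast]; exact Rat.num_div_den y
  have hpq := Int.isCoprime_iff_nat_coprime.1 h
  have hyc : Nat.Coprime y.num.natAbs (y.den : ℤ).natAbs := by simpa using y.reduced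
  constructor
  · intro hxy
    rw [← hy] at hxy
    rcases lt_or_gt_of_ne hq with hq | hq
    · right
      have := Rat.div_int_inj (a := -p) (b := -q) (by omega) hden (by simpa using hpq) hyc
        (by push_cast at hxy ⊢; rw [neg_div_neg_eq, hxy])
      ext <;> simp <;> omega
    · left
      have := Rat.div_int_inj hq hden hpq hyc hxy
      ext <;> simp <;> omega
  · rintro (h | h) <;> rw [Prod.mk.injEq] at h <;> rw [h.1, h.2]
    · exact hy
    · rw [Int.cast_neg, Int.cast_neg, neg_div_neg_eq, hy]

/-- The pair (num, den) gives homogeneous coordinates of `x`, and its image is again coprime, hence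
determined up to sign by the quotient. Second coordinate 0 is the value ∞, which is never `y`. -/
theorem flt_eq_iff (M : SL(2, ℤ)) (x y : ℚ) :
    flt M (OnePoint.some x) = OnePoint.some y ↔
      apply M (x.num, (x.den : ℤ)) = (y.num, (y.den : ℤ)) ∨
      apply M (x.num, (x.den : ℤ)) = (-y.num, -(y.den : ℤ)) := by
  have hx : IsCoprime x.num (x.den : ℤ) := by
    rw [Int.isCoprime_iff_nat_coprime]; simpa using x.reduced
  have hden : (x.den : ℚ) ≠ 0 := by exact_mod_cast x.den_nz
  have hcop := isCoprime_apply M (v := (x.num, (x.den : ℤ))) hx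
  have h1 : (((apply M (x.num, (x.den : ℤ))).1 : ℤ) : ℚ) =
      ((M 0 0 : ℚ) * x + M 0 1) * x.den := by
    simp only [apply]; push_cast
    rw [add_mul, mul_assoc, Rat.mul_den_eq_num]
  have h2 : (((apply M (x.num, (x.den : ℤ))).2 : ℤ) : ℚ) =
      ((M 1 0 : ℚ) * x + M 1 1) * x.den := by
    simp only [apply]; push_cast
    rw [add_mul, mul_assoc, Rat.mul_den_eq_num]
  generalize apply M (x.num, (x.den : ℤ)) = v at *
  obtain ⟨p, q⟩ := v
  simp only at hcop h1 h2
  change (if (M 1 0 : ℚ) * x + M 1 1 = 0 then OnePoint.infty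
    else OnePoint.some (((M 0 0 : ℚ) * x + M 0 1) / ((M 1 0 : ℚ) * x + M 1 1))) = _ ↔ _
  split_ifs with h0
  · have hq : q = 0 := by rw [h0, zero_mul] at h2; exact_mod_cast h2
    have hy : (y.den : ℤ) ≠ 0 := by exact_mod_cast y.den_nz
    constructor
    · intro h; exact absurd h (OnePoint.infty_ne_coe y)
    · rintro (h | h) <;> rw [Prod.mk.injEq] at h <;> omega
  · have hq : q ≠ 0 := by
      rintro rfl
      rw [Int.cast_zero, eq_comm, mul_eq_zero] at h2
      tauto
    rw [← div_eq_rat_iff hcop hq, h1, h2, mul_div_mul_right _ _ hden]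
    exact OnePoint.coe_eq_coe

theorem _root_.ComputablePred.or {α : Type} [Primcodable α] {p q : α → Prop}
    (hp : ComputablePred p) (hq : ComputablePred q) : ComputablePred fun a => p a ∨ q a := by
  obtain ⟨f, hf, rfl⟩ := ComputablePred.computable_iff.1 hp
  obtain ⟨g, hg, rfl⟩ := ComputablePred.computable_iff.1 hq
  exact ComputablePred.computable_iff.2 ⟨fun a => f a || g a,
    Primrec.or.to_comp.comp hf hg, by simp⟩

theorem isDecidable_fltReachable : IsDecidable (RegularInput.enc encRat) FLTReachable := by
  obtain ⟨f, hf, hfv⟩ := exists_computable_words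
  refine ⟨fun c => VectorPath (regularVectorInput (f c.1) c.2.1 (c.2.2.1.1, (c.2.2.1.2 : ℤ))
      (c.2.2.2.1, (c.2.2.2.2 : ℤ))) ∨ VectorPath (regularVectorInput (f c.1) c.2.1
      (c.2.2.1.1, (c.2.2.1.2 : ℤ)) (-c.2.2.2.1, -(c.2.2.2.2 : ℤ))), ?_, fun I => ?_⟩
  · refine .or
      (computablePred_regularVectorInput (hf.comp Computable.fst) (g := fun c : List ((ℤ × ℤ) × (ℤ × ℤ)) ×
        (ℕ × List (ℕ × ℕ × ℕ) × List ℕ × List ℕ) × (ℤ × ℕ) × (ℤ × ℕ) => (c.2.1,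
        (c.2.2.1.1, (c.2.2.1.2 : ℤ)), (c.2.2.2.1, (c.2.2.2.2 : ℤ)))) ?_)
      (computablePred_regularVectorInput (hf.comp Computable.fst) (g := fun c : List ((ℤ × ℤ) × (ℤ × ℤ)) ×
        (ℕ × List (ℕ × ℕ × ℕ) × List ℕ × List ℕ) × (ℤ × ℕ) × (ℤ × ℕ) => (c.2.1,
        (c.2.2.1.1, (c.2.2.1.2 : ℤ)), (-c.2.2.2.1, -(c.2.2.2.2 : ℤ)))) ?_) <;> fun_prop
  · simp only [RegularInput.enc]
    rw [vectorPath_regularVectorInput_iff (hfv I.M), vectorPath_regularVectorInput_iff (hfv I.M)]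
    simp only [FLTReachable, flt_eq_iff, encRat, RegularInput.lang, RegularInput.wordProd,
      and_or_left, exists_or]

/-! ### Products of powers -/

/-- `IsPowProd l g`: `g` is an ordered product of powers, with exponents in `ℕ`, of the terms
of `l`. -/
def IsPowProd : List SL(2, ℤ) → SL(2, ℤ) → Prop
  | [], g => g = 1
  | a :: l, g => ∃ (n : ℕ) (h : SL(2, ℤ)), IsPowProd l h ∧ g = a ^ n * h

theorem isPowProd_append {l l' : List SL(2, ℤ)} {g : SL(2, ℤ)} :
    IsPowProd (l ++ l') g ↔ ∃ h h', IsPowProd l h ∧ IsPowProd l' h' ∧ g = h * h' := by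
  induction l generalizing g with
  | nil => simp [IsPowProd]
  | cons a l ih =>
    simp only [List.cons_append, IsPowProd, ih]
    constructor
    · rintro ⟨n, _, ⟨h, h', h1, h2, rfl⟩, rfl⟩
      exact ⟨_, h', ⟨n, h, h1, rfl⟩, h2, (mul_assoc _ _ _).symm⟩
    · rintro ⟨_, h', ⟨n, h, h1, rfl⟩, h2, rfl⟩
      exact ⟨n, _, ⟨h, h', h1, h2, rfl⟩, mul_assoc _ _ _⟩

/-- Inversion reverses the order of the factors and inverts each base, keeping the exponents in `ℕ`.
-/
theorem isPowProd_reverse_inv {l : List SL(2, ℤ)} {g : SL(2, ℤ)} :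
    IsPowProd (l.map (·⁻¹)).reverse g ↔ IsPowProd l g⁻¹ := by
  induction l generalizing g with
  | nil => simp [IsPowProd]
  | cons a l ih =>
    rw [List.map_cons, List.reverse_cons, isPowProd_append]
    simp only [ih, IsPowProd]
    constructor
    · rintro ⟨h, _, h1, ⟨n, _, rfl, rfl⟩, rfl⟩
      exact ⟨n, h⁻¹, h1, by simp⟩
    · rintro ⟨n, h, h1, hg⟩
      refine ⟨h⁻¹, _, by simpa using h1, ⟨n, 1, rfl, rfl⟩, ?_⟩
      rw [← inv_inj, hg]
      simp

theorem powProd_succ {k : ℕ} (M : Fin (k + 1) → SL(2, ℤ)) (e : Fin (k + 1) → ℤ) :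
    powProd M e = M 0 ^ e 0 * powProd (fun i => M i.succ) (fun i => e i.succ) := by
  simp [powProd, List.ofFn_succ]

theorem isPowProd_ofFn {k : ℕ} (M : Fin k → SL(2, ℤ)) (g : SL(2, ℤ)) :
    IsPowProd (List.ofFn M) g ↔ ∃ e : Fin k → ℕ, powProd M (fun i => (e i : ℤ)) = g := by
  induction k generalizing g with
  | zero => simp [IsPowProd, powProd, eq_comm]
  | succ k ih =>
    rw [List.ofFn_succ]
    simp only [IsPowProd, ih, powProd_succ]
    constructor
    · rintro ⟨n, _, ⟨e, rfl⟩, rfl⟩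
      exact ⟨Fin.cons n e, by simp⟩
    · rintro ⟨e, rfl⟩
      exact ⟨e 0, _, ⟨fun i => e i.succ, rfl⟩, by simp⟩

theorem isPowProd_ofFn_int {k : ℕ} (M : Fin k → SL(2, ℤ)) (g : SL(2, ℤ)) :
    IsPowProd ((List.ofFn M).flatMap fun a => [a, a⁻¹]) g ↔ ∃ e : Fin k → ℤ, powProd M e = g := by
  induction k generalizing g with
  | zero => simp [IsPowProd, powProd, eq_comm]
  | succ k ih =>
    rw [List.ofFn_succ, List.flatMap_cons]
    simp only [List.cons_append, List.nil_append, IsPowProd, ih, powProd_succ]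
    constructor
    · rintro ⟨n, _, ⟨n', _, ⟨e, rfl⟩, rfl⟩, rfl⟩
      refine ⟨Fin.cons ((n : ℤ) - n') e, ?_⟩
      simp [zpow_sub, mul_assoc]
    · rintro ⟨e, rfl⟩
      -- Positive and negative parts of the exponent: a^e = a^n (a⁻¹)^n' with e = n - n'.
      refine ⟨(e 0).toNat, _, ⟨(-e 0).toNat, _, ⟨fun i => e i.succ, rfl⟩, rfl⟩, ?_⟩
      rw [← mul_assoc, ← zpow_natCast, ← zpow_natCast, inv_zpow, ← zpow_neg, ← zpow_add]
      congr 2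
      omega

/-- A graph whose paths from the vertex `us.length` to the vertex `0` spell the products of powers
of the terms of `us`, together with that vertex. -/
def powGraph (us : List (List Bool)) : ℕ × List Edge :=
  us.foldr (fun u s => (s.1 + 1, (s.1 + 1, u, s.1 + 1) :: (s.1 + 1, [], s.1) :: s.2)) (0, [])

theorem powGraph_cons (u : List Bool) (us : List (List Bool)) :
    powGraph (u :: us) = ((powGraph us).1 + 1, ((powGraph us).1 + 1, u, (powGraph us).1 + 1) ::
      ((powGraph us).1 + 1, [], (powGraph us).1) :: (powGraph us).2) := rfl

theorem le_of_mem_powGraph {us : List (List Bool)} {e : Edge} (he : e ∈ (powGraph us).2) :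
    e.1 ≤ (powGraph us).1 ∧ e.2.2 ≤ (powGraph us).1 := by
  induction us with
  | nil => simp [powGraph] at he
  | cons u us ih =>
    rw [powGraph_cons] at he ⊢
    simp only [List.mem_cons] at he
    rcases he with rfl | rfl | he
    · exact ⟨le_rfl, le_rfl⟩
    · exact ⟨le_rfl, Nat.le_succ _⟩
    · exact ⟨(ih he).1.trans (Nat.le_succ _), (ih he).2.trans (Nat.le_succ _)⟩

/-- The new vertex is the highest and no edge enters it from below, so a path starting lower never
uses the two new edges. -/
theorem Run.of_powGraph_cons {u : List Bool} {us : List (List Bool)} {q r : ℕ} {w : List Bool}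
    (h : Run (powGraph (u :: us)).2 q w r) (hq : q ≤ (powGraph us).1) :
    Run (powGraph us).2 q w r := by
  induction h with
  | nil => exact .nil _
  | cons he _ ih =>
    rw [powGraph_cons] at he
    simp only [List.mem_cons, Prod.mk.injEq] at he
    rcases he with he | he | he
    · omega
    · omega
    · exact .cons he (ih (le_of_mem_powGraph he).2)

/-- The loop at the top vertex, taken n times, spells the n-th power of the first factor; the empty
edge then descends to the remaining factors. -/
theorem exists_run_powGraph_iff {us : List (List Bool)} {g : SL(2, ℤ)} :
    (∃ w, Run (powGraph us).2 (powGraph us).1 w 0 ∧ eval w = g) ↔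
      IsPowProd (us.map eval) g := by
  induction us generalizing g with
  | nil =>
    constructor
    · rintro ⟨w, hw, rfl⟩
      cases hw with
      | nil => rfl
      | cons he => simp [powGraph] at he
    · rintro rfl
      exact ⟨[], .nil _, rfl⟩
  | cons u us ih =>
    simp only [List.map_cons, IsPowProd, ← ih]
    constructor
    · rintro ⟨w, hw, rfl⟩
      have key : ∀ {q r : ℕ} {w : List Bool}, Run (powGraph (u :: us)).2 q w r → r = 0 →
          q = (powGraph us).1 + 1 → ∃ (n : ℕ) (h : SL(2, ℤ)),
          (∃ w, Run (powGraph us).2 (powGraph us).1 w 0 ∧ eval w = h) ∧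
            eval w = eval u ^ n * h := by
        intro q r w h hr hq
        induction h with
        | nil => omega
        | @cons q q' r v w he h' ih' =>
          subst hr
          have he' := he
          rw [powGraph_cons] at he'
          simp only [List.mem_cons, Prod.mk.injEq] at he'
          rcases he' with ⟨-, rfl, hq'⟩ | ⟨-, rfl, rfl⟩ | he'
          · obtain ⟨n, h, hh, hw⟩ := ih' rfl hq'
            exact ⟨n + 1, h, hh, by rw [eval_append, hw, pow_succ', mul_assoc]⟩
          · exact ⟨0, _, ⟨w, h'.of_powGraph_cons le_rfl, rfl⟩, by simp⟩
          · have := (le_of_mem_powGraph he').1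
            omega
      exact key hw rfl rfl
    · rintro ⟨n, _, ⟨w, hw, rfl⟩, rfl⟩
      induction n with
      | zero =>
        refine ⟨[] ++ w, .cons (r := (powGraph us).1) ?_ (hw.mono ?_), by simp⟩
        · simp [powGraph_cons]
        · exact fun e he => by simp [powGraph_cons, he]
      | succ n ihn =>
        obtain ⟨v, hv, hvw⟩ := ihn
        refine ⟨u ++ v, .cons (r := (powGraph us).1 + 1) ?_ hv, ?_⟩
        · simp [powGraph_cons]
        · rw [eval_append, hvw, pow_succ', mul_assoc]

/-- The graph problem of a matrix equation. -/
def equationVectorInput (us vs : List (List Bool)) (x y : ℤ × ℤ) : VectorInput :=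
  ((powGraph ((vs.map invWord).reverse ++ us)).2,
    [(powGraph ((vs.map invWord).reverse ++ us)).1], [0], x, y)

/-- g x = h y is rewritten as h⁻¹ g x = y, where h⁻¹ g is again an ordered product of powers. -/
theorem vectorPath_equationVectorInput_iff (us vs : List (List Bool)) (x y : ℤ × ℤ) :
    VectorPath (equationVectorInput us vs x y) ↔ ∃ g h, IsPowProd (us.map eval) g ∧
      IsPowProd (vs.map eval) h ∧ apply g x = apply h y := by
  have h1 : VectorPath (equationVectorInput us vs x y) ↔
      ∃ g, IsPowProd (((vs.map invWord).reverse ++ us).map eval) g ∧ apply g x = y := by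
    simp only [VectorPath, equationVectorInput, List.mem_singleton, exists_eq_left,
      ← exists_run_powGraph_iff, act_eq_apply]
    constructor
    · rintro ⟨w, hw, hxy⟩
      exact ⟨_, ⟨w, hw, rfl⟩, hxy⟩
    · rintro ⟨_, ⟨w, hw, rfl⟩, hxy⟩
      exact ⟨w, hw, hxy⟩
  have h2 : (vs.map invWord).reverse.map eval = ((vs.map eval).map (·⁻¹)).reverse := by
    rw [List.map_reverse, List.map_map, List.map_map]
    congr 2
    exact funext eval_invWord
  rw [h1, List.map_append, h2]
  simp only [isPowProd_append, isPowProd_reverse_inv]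
  constructor
  · rintro ⟨_, ⟨h, g, hh, hg, rfl⟩, hxy⟩
    refine ⟨g, h⁻¹, hg, hh, ?_⟩
    rw [apply_mul] at hxy
    rwa [← apply_eq_iff]
  · rintro ⟨g, h, hg, hh, hxy⟩
    refine ⟨h⁻¹ * g, ⟨h⁻¹, g, by simpa using hh, hg, rfl⟩, ?_⟩
    rw [apply_mul, hxy, eq_comm, ← apply_eq_iff]

theorem primrec_equationVectorInput : Primrec fun c : List (List Bool) × List (List Bool) ×
    (ℤ × ℤ) × (ℤ × ℤ) => equationVectorInput c.1 c.2.1 c.2.2.1 c.2.2.2 := by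
  have h : Primrec powGraph := by
    unfold powGraph
    refine Primrec.list_foldr (by fun_prop) (by fun_prop) (Primrec.to₂ (f := fun p :
      List (List Bool) × (List Bool × (ℕ × List Edge)) => (p.2.2.1 + 1,
        (p.2.2.1 + 1, p.2.1, p.2.2.1 + 1) :: (p.2.2.1 + 1, [], p.2.2.1) :: p.2.2.2)) ?_)
    fun_prop
  unfold equationVectorInput
  fun_prop

theorem computablePred_equationVectorInput {γ : Type} [Primcodable γ]
    {f g : γ → List (List Bool)} (hf : Computable f) (hg : Computable g)
    {x : γ → (ℤ × ℤ) × (ℤ × ℤ)} (hx : Primrec x) :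
    ComputablePred fun c => VectorPath (equationVectorInput (f c) (g c) (x c).1 (x c).2) := by
  have h := primrec_equationVectorInput.to_comp.comp (hf.pair (hg.pair hx.to_comp))
  dsimp only at h
  exact ComputablePred.comp_computable computablePred_vectorPath h

/-- The map `h` prepares the list of bases: the identity for exponents in `ℕ`, and insertion of each
inverse after its base for exponents in `ℤ`. -/
theorem isDecidable_equation {Q : EquationInput → Prop} (h : List (List Bool) → List (List Bool))
    (hh : Primrec h) (hQ : ∀ (I : EquationInput) (us vs : List (List Bool)),
      us.map eval = List.ofFn I.M → vs.map eval = List.ofFn I.N →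
      (Q I ↔ ∃ g g', IsPowProd ((h us).map eval) g ∧ IsPowProd ((h vs).map eval) g' ∧
        apply g (encVec I.x) = apply g' (encVec I.y))) : IsDecidable EquationInput.enc Q := by
  obtain ⟨f, hf, hfv⟩ := exists_computable_words
  refine ⟨fun c => VectorPath (equationVectorInput (h (f c.1)) (h (f c.2.1)) c.2.2.1 c.2.2.2),
    computablePred_equationVectorInput (hh.to_comp.comp (hf.comp Computable.fst))
      (hh.to_comp.comp (hf.comp (Computable.fst.comp Computable.snd)))
      (x := fun c => c.2.2) (Primrec.snd.comp Primrec.snd), fun I => ?_⟩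
  simp only [EquationInput.enc]
  rw [vectorPath_equationVectorInput_iff, hQ I _ _ (hfv I.M) (hfv I.N)]

theorem holds_iff (I : EquationInput) (e : Fin I.k → ℤ) (f : Fin I.l → ℤ) :
    I.Holds e f ↔ apply (powProd I.M e) (encVec I.x) = apply (powProd I.N f) (encVec I.y) := by
  rw [apply_encVec, apply_encVec, encVec_injective.eq_iff, EquationInput.Holds]

theorem isDecidable_solvableNat : IsDecidable EquationInput.enc EquationInput.SolvableNat := by
  refine isDecidable_equation id Primrec.id fun I us vs hus hvs => ?_
  simp only [id, hus, hvs, isPowProd_ofFn, EquationInput.SolvableNat, holds_iff]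
  constructor
  · rintro ⟨e, f, h⟩
    exact ⟨_, _, ⟨e, rfl⟩, ⟨f, rfl⟩, h⟩
  · rintro ⟨_, _, ⟨e, rfl⟩, ⟨f, rfl⟩, h⟩
    exact ⟨e, f, h⟩

theorem isDecidable_solvableInt : IsDecidable EquationInput.enc EquationInput.SolvableInt := by
  refine isDecidable_equation (fun us => us.flatMap fun u => [u, invWord u]) (by fun_prop)
    fun I us vs hus hvs => ?_
  have hmap : ∀ us : List (List Bool), (us.flatMap fun u => [u, invWord u]).map eval =
      (us.map eval).flatMap fun a => [a, a⁻¹] := by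
    intro us
    simp [List.map_flatMap, List.flatMap_map, eval_invWord]
  simp only [hmap, hus, hvs, isPowProd_ofFn_int, EquationInput.SolvableInt, holds_iff]
  constructor
  · rintro ⟨e, f, h⟩
    exact ⟨_, _, ⟨e, rfl⟩, ⟨f, rfl⟩, h⟩
  · rintro ⟨_, _, ⟨e, rfl⟩, ⟨f, rfl⟩, h⟩
    exact ⟨e, f, h⟩

end SL2Reach

theorem mainTheorem6 :
    SL2Reach.IsDecidable (SL2Reach.RegularInput.enc SL2Reach.encVec) SL2Reach.VectorReachable ∧
    SL2Reach.IsDecidable (SL2Reach.RegularInput.enc SL2Reach.encRat) SL2Reach.FLTReachable ∧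
    SL2Reach.IsDecidable SL2Reach.EquationInput.enc SL2Reach.EquationInput.SolvableNat ∧
    SL2Reach.IsDecidable SL2Reach.EquationInput.enc SL2Reach.EquationInput.SolvableInt :=
  ⟨SL2Reach.isDecidable_vectorReachable, SL2Reach.isDecidable_fltReachable,
    SL2Reach.isDecidable_solvableNat, SL2Reach.isDecidable_solvableInt⟩
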